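/- **Polytope complexes.** A *polytope complex* $\mathcal C$ is a small double category (objects, vertical morphisms $a\dashrightarrow b$, horizontal morphisms $a\to b$, and a class of commutative squares with horizontal top and bottom and vertical sides, containing the identity squares and closed under horizontal and vertical composition) such that: * (V) vertically $\mathcal C$ is a preorder with a unique initial object $\varnothing$ and with pullbacks, and it carries a Grothendieck topology; every covering family of an object $a\neq\varnothing$ contains some $a_i\dashrightarrow a$ with $a_i\ne\varnothing$; * (H) horizontally $\mathcal C$ is a groupoid; * (P) every pair consisting of a horizontal $\Sigma:a\to b$ and a vertical $b'\dashrightarrow b$ can be completed to a commutative square with left side $\Sigma^*b'\dashrightarrow a$ and top $\Sigma^*b'\to b'$. The completing square is unique up to vertical isomorphism: for two completions $\tau_1:a_1\to b'$ and $\tau_2:a_2\to b'$ there is a vertical $a_1\dashrightarrow a_2$ forming, with $\tau_1$, $\tau_2$ and $\mathrm{id}_{b'}$, a commutative square. The top morphism is determined by the other three sides. The resulting functor $\Sigma^*:(\mathcal C_v\downarrow b)\to(\mathcal C_v\downarrow a)$ is an equivalence; * (C) if $\{x_\alpha\dashrightarrow x\}$ is a covering family and $\Sigma:y\to x$ is horizontal,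 then $\{\Sigma^*x_\alpha\dashrightarrow y\}$ is a covering family; * (B) if $\{x_{\alpha\beta}\dashrightarrow x_\alpha\}_\beta$ is a covering family for each $\alpha$ and $\{x_{\alpha\beta}\dashrightarrow x\}_{\alpha,\beta}$ is a covering family, then so is $\{x_\alpha\dashrightarrow x\}_\alpha$. The *polytopes* of $\mathcal C$ are the objects $\neq\varnothing$. A *polytope functor* is a double functor which vertically preserves $\varnothing$, pullbacks and covering families (and hence preserves the squares of (P)). Polytope complexes and polytope functors form a category $\mathbf{PolyCpx}$. **The category $SC(\mathcal C)$.** Its objects are finite families $\{a_i\}_{i\in I}$ of polytopes, the index sets being finite sets of natural numbers. A *sub-map* $p:\{a_i\}_{i\in I}\dashrightarrow\{b_j\}_{j\in J}$ is a map $p:I\to J$ with vertical morphisms $a_i\dashrightarrow b_{p(i)}$ such that $a_i\times_{b_j}a_{i'}=\varnothing$ for distinct $i,i'\in p^{-1}(j)$; it is *covering* if $\{a_i\dashrightarrow b_j\}_{i\in p^{-1}(j)}$ is a covering family for every $j\in J$. A *shuffle* $\sigma:\{a_i\}_{i\in I}\to\{b_j\}_{j\in J}$ is a map $\sigma:I\to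 J$ with horizontal morphisms $\Sigma_i:a_i\to b_{\sigma(i)}$. A morphism $A\to B$ of $SC(\mathcal C)$ is a class of diagrams $A\overset{p}{\dashleftarrow}A'\overset{\sigma}{\to}B$ ($p$ a sub-map, $\sigma$ a shuffle), up to vertical isomorphisms of $A'$ (bijections of the index sets with vertical isomorphisms of the components) compatible with $p$ and $\sigma$. The composite with $B\overset{q}{\dashleftarrow}B'\overset{\tau}{\to}D$ is $A\dashleftarrow A'\dashleftarrow\sigma^*B'\to B'\to D$, where $\sigma^*B'=\{\Sigma_i^*b'_j\}_{\sigma(i)=q(j)}$. The morphism is a *cofibration* (resp. *weak equivalence*) if $p$ is covering and $\sigma$ is injective (resp. bijective) on index sets. A polytope functor $F$ induces $SC(F)$, which sends $\{a_i\}$ to $\{F(a_i)\}$, omitting the indices with $F(a_i)=\varnothing$, and acts accordingly on diagrams. **Theorem.** $SC$ is a functor from $\mathbf{PolyCpx}$ to the category of Waldhausen categories and exact functors. Each Waldhausen category $SC(\mathcal C)$ satisfies * the saturation axiom: if two of $f,g,gf$ are weak equivalences, so is the third; * the extension axiom: if a map of cofibration sequences $(A\to B\to B/A)\to(A'\to B'\to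 B'/A')$ is a weak equivalence on $A\to A'$ and on $B/A\to B'/A'$, then $B\to B'$ is a weak equivalence; * canonical splitting: for every cofibration sequence $A\to B\to B/A$ the map $B\to B/A$ has exactly one section, this section is a cofibration, and the induced map $A\amalg B/A\to B$ is a weak equivalence. Moreover $[a]\mapsto[\{a\}]$ defines an isomorphism onto $K_0SC(\mathcal C)$ from the free abelian group on the polytopes of $\mathcal C$ modulo the relations $[a]=\sum_{i\in I}[a_i]$ for covering sub-maps $\{a_i\}_{i\in I}\dashrightarrow\{a\}$ and $[a]=[b]$ for horizontal morphisms $a\to b$. Here $K_0$ of a Waldhausen category is the free abelian group on its objects modulo $[A]=[B]$ for weak equivalences $A\to B$ and $[B]=[A]+[B/A]$ for cofibration sequences $A\to B\to B/A$. -/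

import Mathlib

open CategoryTheory CategoryTheory.Limits

universe w v u v' u'

/-! ## Double categories that are vertically a preorder -/

/-- A double category whose vertical category is a preorder: a vertical morphism `a ⇢ b` is the
relation `a ≤ b`.  Horizontal morphisms form a category, and `Sq σ τ` says that the square

    a --σ--> b
    ⋮        ⋮
    c --τ--> d

(with vertical sides `a ≤ c` and `b ≤ d`) is one of the commutative squares. -/
structure DoublePreorder where
  Ob : Type u
  [vert : Preorder Ob]
  Hor : Ob → Ob → Type v
  hid : ∀ a, Hor a a
  hcomp : ∀ {a b c}, Hor a b → Hor b c → Hor a c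
  hid_comp : ∀ {a b} (σ : Hor a b), hcomp (hid a) σ = σ
  hcomp_id : ∀ {a b} (σ : Hor a b), hcomp σ (hid b) = σ
  hassoc : ∀ {a b c d} (σ : Hor a b) (τ : Hor b c) (ρ : Hor c d),
    hcomp (hcomp σ τ) ρ = hcomp σ (hcomp τ ρ)
  Sq : ∀ {a b c d}, Hor a b → Hor c d → Prop
  sq_left : ∀ {a b c d} {σ : Hor a b} {τ : Hor c d}, Sq σ τ → a ≤ c
  sq_right : ∀ {a b c d} {σ : Hor a b} {τ : Hor c d}, Sq σ τ → b ≤ d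
  sq_vid : ∀ {a b} (σ : Hor a b), Sq σ σ
  sq_hid : ∀ {a c}, a ≤ c → Sq (hid a) (hid c)
  sq_vcomp : ∀ {a b c d e f} {σ : Hor a b} {τ : Hor c d} {ρ : Hor e f},
    Sq σ τ → Sq τ ρ → Sq σ ρ
  sq_hcomp : ∀ {a b c d e f} {σ : Hor a b} {σ' : Hor b c} {τ : Hor d e} {τ' : Hor e f},
    Sq σ τ → Sq σ' τ' → Sq (hcomp σ σ') (hcomp τ τ')

attribute [instance] DoublePreorder.vert

/-- The family `x i ⇢ a` of vertical morphisms is a covering family of `a`: the sieve it generates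
is covering. -/
def IsCoveringFamily {X : Type u} [Preorder X] (J : GrothendieckTopology X) {ι : Type w}
    (x : ι → X) (a : X) : Prop :=
  ∃ h : ∀ i, x i ≤ a, Sieve.ofArrows x (fun i => homOfLE (h i)) ∈ J a

/-! ## Polytope complexes -/

/-- A polytope complex. -/
structure PolytopeComplex extends DoublePreorder.{v, u} where
  /-- (V) the unique (vertically) initial object -/
  bot : Ob
  bot_le : ∀ a, bot ≤ a
  eq_bot : ∀ {a}, a ≤ bot → a = bot
  /-- (V) vertical pullbacks; in a preorder `a ×_c b` is a greatest lower bound of `a, b ≤ c` -/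
  exists_pullback : ∀ {a b c : Ob}, a ≤ c → b ≤ c → ∃ d, IsGLB {a, b} d
  /-- (V) the topology on the vertical category -/
  J : GrothendieckTopology Ob
  /-- every covering family of a polytope contains a polytope -/
  nondegenerate : ∀ {ι : Type u} {x : ι → Ob} {a : Ob},
    IsCoveringFamily J x a → (∀ i, x i = bot) → a = bot
  /-- (H) horizontally a groupoid -/
  hinv : ∀ {a b}, Hor a b → Hor b a
  hinv_comp : ∀ {a b} (σ : Hor a b), hcomp (hinv σ) σ = hid b
  hcomp_inv : ∀ {a b} (σ : Hor a b), hcomp σ (hinv σ) = hid a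
  /-- (P) a horizontal `Σ : a → b` and a vertical `b' ⇢ b` can be completed to a commutative
  square ... -/
  exists_sq : ∀ {a b b'} (σ : Hor a b), b' ≤ b → ∃ (a' : Ob) (τ : Hor a' b'), Sq τ σ
  /-- ... which is unique up to vertical isomorphism: any two completions map to each other ... -/
  sq_unique : ∀ {a b b' a₁ a₂} {σ : Hor a b} {τ₁ : Hor a₁ b'} {τ₂ : Hor a₂ b'},
    Sq τ₁ σ → Sq τ₂ σ → Sq τ₁ τ₂
  /-- ... and whose horizontal filler is unique. -/
  filler_unique : ∀ {a b b' a'} {σ : Hor a b} {τ₁ τ₂ : Hor a' b'},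
    Sq τ₁ σ → Sq τ₂ σ → τ₁ = τ₂
  /-- (P) the resulting `Σ^* : (C_v ↓ b) → (C_v ↓ a)` is well defined on morphisms and fully
  faithful ... -/
  sq_le_iff : ∀ {a b a₁ b₁ a₂ b₂} {σ : Hor a b} {τ₁ : Hor a₁ b₁} {τ₂ : Hor a₂ b₂},
    Sq τ₁ σ → Sq τ₂ σ → (a₁ ≤ a₂ ↔ b₁ ≤ b₂)
  /-- ... and essentially surjective. -/
  sq_surj : ∀ {a b a'} (σ : Hor a b), a' ≤ a →
    ∃ (a'' b' : Ob) (τ : Hor a'' b'), Sq τ σ ∧ a'' ≤ a' ∧ a' ≤ a''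
  /-- (C) covering families are stable under `Σ^*` -/
  cover_pull : ∀ {ι : Type u} {x y : ι → Ob} {a b} (σ : Hor a b) (τ : ∀ i, Hor (y i) (x i)),
    (∀ i, Sq (τ i) σ) → IsCoveringFamily J x b → IsCoveringFamily J y a
  /-- (B) -/
  cover_refine : ∀ {ι : Type u} {κ : ι → Type u} {x : ι → Ob} {y : ∀ i, κ i → Ob} {a : Ob},
    (∀ i, x i ≤ a) → (∀ i, IsCoveringFamily J (y i) (x i)) →
    IsCoveringFamily J (fun z : (Σ i, κ i) => y z.1 z.2) a → IsCoveringFamily J x a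

namespace PolytopeComplex

variable (C : PolytopeComplex.{v, u})

/-- A polytope is a noninitial object. -/
def Polytope : Type u := {a : C.Ob // a ≠ C.bot}

end PolytopeComplex

/-- A polytope functor: a double functor which vertically preserves the initial object, pullbacks
and covering families.  Commutative squares being preserved, and all of them being pullback
squares, `F (Σ^* P) ≅ F (Σ)^* F (P)`. -/
@[ext]
structure PolytopeFunctor (C D : PolytopeComplex.{v, u}) where
  obj : C.Ob → D.Ob
  mono : ∀ {a b}, a ≤ b → obj a ≤ obj b
  hmap : ∀ {a b}, C.Hor a b → D.Hor (obj a) (obj b)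
  hmap_id : ∀ a, hmap (C.hid a) = D.hid (obj a)
  hmap_comp : ∀ {a b c} (σ : C.Hor a b) (τ : C.Hor b c),
    hmap (C.hcomp σ τ) = D.hcomp (hmap σ) (hmap τ)
  sq : ∀ {a b c d} {σ : C.Hor a b} {τ : C.Hor c d}, C.Sq σ τ → D.Sq (hmap σ) (hmap τ)
  map_bot : obj C.bot = D.bot
  map_pullback : ∀ {a b c d : C.Ob}, a ≤ c → b ≤ c → IsGLB {a, b} d →
    IsGLB {obj a, obj b} (obj d)
  map_cover : ∀ {ι : Type u} {x : ι → C.Ob} {a : C.Ob},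
    IsCoveringFamily C.J x a → IsCoveringFamily D.J (fun i => obj (x i)) (obj a)

/-- The category of polytope complexes and polytope functors. -/
instance : Category PolytopeComplex.{v, u} where
  Hom := PolytopeFunctor
  id C :=
    { obj := fun a => a, mono := fun h => h, hmap := fun σ => σ, hmap_id := fun _ => rfl,
      hmap_comp := fun _ _ => rfl, sq := fun h => h, map_bot := rfl,
      map_pullback := fun _ _ h => h, map_cover := fun h => h }
  comp F G :=
    { obj := fun a => G.obj (F.obj a)
      mono := fun h => G.mono (F.mono h)
      hmap := fun σ => G.hmap (F.hmap σ)
      hmap_id := fun a => by rw [F.hmap_id, G.hmap_id]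
      hmap_comp := fun σ τ => by rw [F.hmap_comp, G.hmap_comp]
      sq := fun h => G.sq (F.sq h)
      map_bot := by rw [F.map_bot, G.map_bot]
      map_pullback := fun ha hb h => G.map_pullback (F.mono ha) (F.mono hb)
        (F.map_pullback ha hb h)
      map_cover := fun h => G.map_cover (F.map_cover h) }

namespace PolytopeComplex

variable {C : PolytopeComplex.{v, u}}

theorem isGLB_bot_iff {a b : C.Ob} :
    IsGLB {a, b} C.bot ↔ ∀ c, c ≤ a → c ≤ b → c = C.bot := by
  constructor
  · intro h c ha hb
    refine C.eq_bot (h.2 ?_)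
    rintro x (rfl | rfl) <;> assumption
  · intro h
    refine ⟨fun x _ => C.bot_le x, fun c hc => ?_⟩
    rw [h c (hc (by simp)) (hc (by simp))]

/-- Pulling back along a fixed horizontal morphism is monotone, compatibly with the fillers. -/
theorem sq_mono {a b a₁ b₁ a₂ b₂ : C.Ob} {σ : C.Hor a b} {τ₁ : C.Hor a₁ b₁} {τ₂ : C.Hor a₂ b₂}
    (h₁ : C.Sq τ₁ σ) (h₂ : C.Sq τ₂ σ) (h : b₁ ≤ b₂) : C.Sq τ₁ τ₂ := by
  obtain ⟨x, ρ, hρ⟩ := C.exists_sq τ₂ h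
  exact C.sq_vcomp (C.sq_unique h₁ (C.sq_vcomp hρ h₂)) hρ

theorem sq_symm {a b c d : C.Ob} {σ : C.Hor a b} {τ : C.Hor c d}
    (h : C.Sq σ τ) (hd : d ≤ b) : C.Sq τ σ :=
  sq_mono (C.sq_vid τ) h hd

theorem left_eq_bot {a b : C.Ob} (σ : C.Hor a b) (hb : b = C.bot) : a = C.bot := by
  obtain ⟨a'', b', τ, hτ, h, -⟩ := C.sq_surj σ (C.bot_le a)
  have h1 : b' = C.bot := C.eq_bot (hb ▸ C.sq_right hτ)
  have : a ≤ a'' := (C.sq_le_iff (C.sq_vid σ) hτ).2 (by rw [hb]; exact C.bot_le _)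
  exact C.eq_bot (this.trans h)

theorem ne_bot_of_le {a b : C.Ob} (h : a ≤ b) (ha : a ≠ C.bot) : b ≠ C.bot := fun hb =>
  ha (C.eq_bot (hb ▸ h))

theorem eq_bot_iff {a b : C.Ob} (σ : C.Hor a b) : a = C.bot ↔ b = C.bot :=
  ⟨left_eq_bot (C.hinv σ), left_eq_bot σ⟩

theorem disjoint_of_sq {a b a₁ b₁ a₂ b₂ : C.Ob} {σ : C.Hor a b} {τ₁ : C.Hor a₁ b₁}
    {τ₂ : C.Hor a₂ b₂} (h₁ : C.Sq τ₁ σ) (h₂ : C.Sq τ₂ σ) (h : IsGLB {b₁, b₂} C.bot) :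
    IsGLB {a₁, a₂} C.bot := by
  rw [isGLB_bot_iff] at h ⊢
  intro c hc₁ hc₂
  obtain ⟨a'', b', τ, hτ, h3, h4⟩ := C.sq_surj σ (hc₁.trans (C.sq_left h₁))
  have := h b' ((C.sq_le_iff hτ h₁).1 (h3.trans hc₁)) ((C.sq_le_iff hτ h₂).1 (h3.trans hc₂))
  have h5 := left_eq_bot τ this
  exact C.eq_bot (h5 ▸ h4)

/-! ### Sub-maps between families -/

/-- The set map `p`, together with the vertical morphisms `x i ⇢ y (p i)`, is a sub-map from the
family `x` to the family `y`. -/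
structure IsSubmap {I : Type*} {K : Type*} (x : I → C.Ob) (y : K → C.Ob) (p : I → K) : Prop where
  le : ∀ i, x i ≤ y (p i)
  disjoint : ∀ i i', i ≠ i' → p i = p i' → IsGLB {x i, x i'} C.bot

/-- A covering sub-map. -/
structure IsCoveringSubmap {I : Type*} {K : Type*} (x : I → C.Ob) (y : K → C.Ob) (p : I → K) :
    Prop extends IsSubmap x y p where
  cover : ∀ k, IsCoveringFamily C.J (fun i : {i // p i = k} => x i.1) (y k)

end PolytopeComplex

/-! ## The category `SC(C)` -/

/-- An object `{a_i}_{i ∈ I}`: a finite family of polytopes.  The index set `I` is a finite set of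
natural numbers, and the family is extended by the initial object outside `I`, so that
`I = {n | a_n ≠ ∅}`. -/
@[ext]
structure SC (C : PolytopeComplex.{v, u}) where
  val : ℕ → C.Ob
  finite : {n | val n ≠ C.bot}.Finite

namespace SC

open PolytopeComplex

variable {C : PolytopeComplex.{v, u}}

/-- The index set of the family. -/
def Idx (A : SC C) : Type := {n : ℕ // A.val n ≠ C.bot}

/-- The polytopes of the family. -/
def elt (A : SC C) (i : A.Idx) : C.Ob := A.val i.1

instance (A : SC C) : Finite A.Idx := A.finite

theorem Idx.transfer {D : PolytopeComplex.{v, u}} {A : SC C} {B : SC D} {i j : A.Idx}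
    {i' j' : B.Idx} (h : i = j) (hi : i'.1 = i.1) (hj : j'.1 = j.1) : i' = j' :=
  Subtype.ext (hi.trans ((congrArg Subtype.val h).trans hj.symm))

/-- A diagram `A ⇠p A' →σ B`: a sub-map `p` and a shuffle `σ` (a set map `f` together with
horizontal morphisms `a'_i → b_{f i}`). -/
structure Span (A B : SC C) where
  apex : SC C
  p : apex.Idx → A.Idx
  sub : IsSubmap apex.elt A.elt p
  f : apex.Idx → B.Idx
  hor : ∀ i, C.Hor (apex.elt i) (B.elt (f i))

/-- Two diagrams are equivalent if there is a vertical isomorphism `ι` of their apices (a bijection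
of index sets and vertical isomorphisms of the components) compatible with both legs. -/
def Span.Equiv {A B : SC C} (S T : Span A B) : Prop :=
  ∃ ι : S.apex.Idx ≃ T.apex.Idx, ∀ i,
    (S.apex.elt i ≤ T.apex.elt (ι i) ∧ T.apex.elt (ι i) ≤ S.apex.elt i) ∧
    T.p (ι i) = S.p i ∧ T.f (ι i) = S.f i ∧ C.Sq (S.hor i) (T.hor (ι i))

theorem Span.Equiv.refl {A B : SC C} (S : Span A B) : S.Equiv S :=
  ⟨_root_.Equiv.refl _, fun _ => ⟨⟨le_rfl, le_rfl⟩, rfl, rfl, C.sq_vid _⟩⟩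

theorem Span.Equiv.symm {A B : SC C} {S T : Span A B} (h : S.Equiv T) : T.Equiv S := by
  obtain ⟨ι, h⟩ := h
  refine ⟨ι.symm, fun i => ?_⟩
  obtain ⟨i, rfl⟩ := ι.surjective i
  obtain ⟨⟨h1, h2⟩, h3, h4, h5⟩ := h i
  rw [ι.symm_apply_apply]
  exact ⟨⟨h2, h1⟩, h3.symm, h4.symm, sq_symm h5 (by rw [h4])⟩

theorem Span.Equiv.trans {A B : SC C} {S T U : Span A B} (h : S.Equiv T) (h' : T.Equiv U) :
    S.Equiv U := by
  obtain ⟨ι, h⟩ := h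
  obtain ⟨ι', h'⟩ := h'
  refine ⟨ι.trans ι', fun i => ?_⟩
  obtain ⟨⟨h1, h2⟩, h3, h4, h5⟩ := h i
  obtain ⟨⟨k1, k2⟩, k3, k4, k5⟩ := h' (ι i)
  exact ⟨⟨h1.trans k1, k2.trans h2⟩, k3.trans h3, k4.trans h4, C.sq_vcomp h5 k5⟩

instance Span.setoid (A B : SC C) : Setoid (Span A B) :=
  ⟨Span.Equiv, Span.Equiv.refl, Span.Equiv.symm, Span.Equiv.trans⟩

/-- The identity diagram. -/
def Span.id (A : SC C) : Span A A where
  apex := A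
  p i := i
  sub := ⟨fun _ => le_rfl, fun _ _ h h' => absurd h' h⟩
  f i := i
  hor _ := C.hid _

section Pull

/-- A chosen pullback `Σ^* b'`. -/
noncomputable def pull {a b b' : C.Ob} (σ : C.Hor a b) (h : b' ≤ b) : C.Ob :=
  (C.exists_sq σ h).choose

/-- The horizontal morphism `Σ^* b' → b'`. -/
noncomputable def pullHor {a b b' : C.Ob} (σ : C.Hor a b) (h : b' ≤ b) : C.Hor (pull σ h) b' :=
  (C.exists_sq σ h).choose_spec.choose

theorem pull_sq {a b b' : C.Ob} (σ : C.Hor a b) (h : b' ≤ b) : C.Sq (pullHor σ h) σ :=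
  (C.exists_sq σ h).choose_spec.choose_spec

end Pull

section OfFamily

variable {I : Type} [Finite I] (x : I → C.Ob) (hx : ∀ i, x i ≠ C.bot) (e : I ↪ ℕ)

open Classical in
/-- The object with components `x i`, the index `i` being renamed to `e i`. -/
noncomputable def ofFamily : SC C where
  val n := if h : ∃ i, e i = n then x h.choose else C.bot
  finite := by
    refine (Set.finite_range e).subset fun n hn => ?_
    by_contra h
    exact hn (dif_neg h)

theorem ofFamily_val (i : I) : (ofFamily x e).val (e i) = x i := by
  have h : ∃ j, e j = e i := ⟨i, rfl⟩
  have h2 : h.choose = i := e.injective h.choose_spec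
  unfold ofFamily
  simp only
  rw [dif_pos h, h2]

/-- The index set of `ofFamily x e` is a copy of `I`. -/
noncomputable def ofFamilyEquiv : (ofFamily x e).Idx ≃ I :=
  (_root_.Equiv.ofBijective
    (fun i : I => (⟨e i, by rw [ofFamily_val]; exact hx i⟩ : (ofFamily x e).Idx))
    ⟨fun i j h => e.injective (congrArg Subtype.val h), fun n => by
      by_cases h : ∃ i, e i = n.1
      · obtain ⟨i, hi⟩ := h
        exact ⟨i, Subtype.ext hi⟩
      · exact absurd (dif_neg h) n.2⟩).symm

theorem ofFamily_elt (i : (ofFamily x e).Idx) :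
    (ofFamily x e).elt i = x (ofFamilyEquiv x hx e i) := by
  obtain ⟨i, rfl⟩ := (ofFamilyEquiv x hx e).symm.surjective i
  rw [_root_.Equiv.apply_symm_apply]
  exact ofFamily_val x e i

end OfFamily

section Comp

variable {A B D : SC C} (S : Span A B) (T : Span B D)

/-- The index set `I' ×_J J'` of the pullback `σ^* B'`. -/
abbrev CompIdx : Type := {z : S.apex.Idx × T.apex.Idx // S.f z.1 = T.p z.2}

theorem compIdx_le (z : CompIdx S T) : T.apex.elt z.1.2 ≤ B.elt (S.f z.1.1) := by
  rw [z.2]; exact T.sub.le _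

/-- The components `Σ_i^* b'_j` of the pullback `σ^* B'`. -/
noncomputable def compFam (z : CompIdx S T) : C.Ob :=
  pull (S.hor z.1.1) (compIdx_le S T z)

/-- The horizontal components of `σ^* B' → B'`. -/
noncomputable def compHor (z : CompIdx S T) : C.Hor (compFam S T z) (T.apex.elt z.1.2) :=
  pullHor (S.hor z.1.1) (compIdx_le S T z)

theorem compHor_sq (z : CompIdx S T) : C.Sq (compHor S T z) (S.hor z.1.1) :=
  pull_sq _ _

theorem compFam_ne (z : CompIdx S T) : compFam S T z ≠ C.bot := fun h =>
  z.1.2.2 ((eq_bot_iff (compHor S T z)).1 h)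

/-- Names for the indices of the pullback. -/
def compCode : CompIdx S T ↪ ℕ where
  toFun z := Nat.pair z.1.1.1 z.1.2.1
  inj' z z' h := by
    have h' := Nat.pair_eq_pair.1 h
    exact Subtype.ext (Prod.ext (Subtype.ext h'.1) (Subtype.ext h'.2))

theorem compFam_submap :
    IsSubmap (compFam S T) A.elt (fun z => S.p z.1.1) where
  le z := (C.sq_left (compHor_sq S T z)).trans (S.sub.le _)
  disjoint := by
    rintro ⟨⟨s, t⟩, hz⟩ ⟨⟨s', t'⟩, hz'⟩ hne hp
    by_cases hs : s = s'
    · subst hs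
      have ht : t ≠ t' := by rintro rfl; exact hne rfl
      exact disjoint_of_sq (compHor_sq S T ⟨⟨s, t⟩, hz⟩) (compHor_sq S T ⟨⟨s, t'⟩, hz'⟩)
        (T.sub.disjoint t t' ht (hz.symm.trans hz'))
    · have := S.sub.disjoint s s' hs hp
      rw [isGLB_bot_iff] at this ⊢
      exact fun c h h' => this c (h.trans (C.sq_left (compHor_sq S T ⟨⟨s, t⟩, hz⟩)))
        (h'.trans (C.sq_left (compHor_sq S T ⟨⟨s', t'⟩, hz'⟩)))

/-- The composite diagram `A ⇠ A' ⇠ σ^* B' → B' → D`. -/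
noncomputable def Span.comp : Span A D where
  apex := ofFamily (compFam S T) (compCode S T)
  p i := S.p (ofFamilyEquiv _ (compFam_ne S T) _ i).1.1
  sub :=
    { le := fun i => by
        rw [ofFamily_elt _ (compFam_ne S T)]
        exact (compFam_submap S T).le _
      disjoint := fun i i' h h' => by
        rw [ofFamily_elt _ (compFam_ne S T), ofFamily_elt _ (compFam_ne S T)]
        exact (compFam_submap S T).disjoint _ _
          (fun h'' => h ((ofFamilyEquiv _ (compFam_ne S T) _).injective h'')) h' }
  f i := T.f (ofFamilyEquiv _ (compFam_ne S T) _ i).1.2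
  hor i := cast (by rw [ofFamily_elt _ (compFam_ne S T)])
    (C.hcomp (compHor S T (ofFamilyEquiv _ (compFam_ne S T) _ i)) (T.hor _))

/-- `U` is a composite of `S` and `T`, for some choice of the pullback. -/
def Span.IsComp (U : Span A D) : Prop :=
  ∃ e : U.apex.Idx ≃ CompIdx S T, ∀ i,
    U.p i = S.p (e i).1.1 ∧ U.f i = T.f (e i).1.2 ∧
    ∃ κ : C.Hor (U.apex.elt i) (T.apex.elt (e i).1.2),
      C.Sq κ (S.hor (e i).1.1) ∧ C.Sq (U.hor i) (C.hcomp κ (T.hor (e i).1.2))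

theorem exists_cast_sq {a a' b b' d : C.Ob} (h : a = a') (κ : C.Hor a' b) (τ : C.Hor b d)
    {c : C.Ob} (σ : C.Hor c b') (hs : C.Sq κ σ) (h' : C.Hor a' d = C.Hor a d) :
    ∃ κ' : C.Hor a b, C.Sq κ' σ ∧ C.Sq (cast h' (C.hcomp κ τ)) (C.hcomp κ' τ) := by
  subst h
  exact ⟨κ, hs, C.sq_vid _⟩

theorem Span.comp_isComp : Span.IsComp S T (Span.comp S T) :=
  ⟨ofFamilyEquiv _ (compFam_ne S T) _, fun _ => ⟨rfl, rfl,
    exists_cast_sq (ofFamily_elt _ (compFam_ne S T) _ _) _ _ _ (compHor_sq S T _) _⟩⟩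

variable {S T}

theorem Span.IsComp.equiv {S' : Span A B} {T' : Span B D} {U U' : Span A D}
    (hU : Span.IsComp S T U) (hU' : Span.IsComp S' T' U') (hS : S ≈ S') (hT : T ≈ T') :
    U ≈ U' := by
  obtain ⟨e, he⟩ := hU
  obtain ⟨e', he'⟩ := hU'
  obtain ⟨ι, hι⟩ := hS
  obtain ⟨μ, hμ⟩ := hT
  let g : CompIdx S T ≃ CompIdx S' T' :=
    (ι.prodCongr μ).subtypeEquiv (fun z => by
      simp only [Equiv.prodCongr_apply, Prod.map]
      rw [(hι _).2.2.1, (hμ _).2.1])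
  have key : ∀ i, ∃ i', e' i' = g (e i) ∧ i' = ((e.trans g).trans e'.symm) i :=
    fun i => ⟨_, by simp, rfl⟩
  refine ⟨(e.trans g).trans e'.symm, fun i => ?_⟩
  obtain ⟨i', h1, h2⟩ := key i
  rw [← h2]
  obtain ⟨a1, a2, κ, a3, a4⟩ := he i
  obtain ⟨b1, b2, κ', b3, b4⟩ := he' i'
  have hg1 : (g (e i)).1.1 = ι (e i).1.1 := rfl
  have hg2 : (g (e i)).1.2 = μ (e i).1.2 := rfl
  clear_value g
  generalize e' i' = z at *
  subst h1
  generalize g (e i) = z at *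
  obtain ⟨⟨s, t⟩, hz⟩ := z
  dsimp only at *
  subst hg1 hg2
  obtain ⟨⟨c1, c2⟩, c3, c4, c5⟩ := hι (e i).1.1
  obtain ⟨⟨d1, d2⟩, d3, d4, d5⟩ := hμ (e i).1.2
  have h3 : C.Sq κ κ' := sq_mono (C.sq_vcomp a3 c5) b3 d1
  have h4 : C.Sq κ' κ := sq_symm h3 d2
  have h5 : C.Sq (U'.hor i') (U'.hor i') := C.sq_vid _
  have hf : U'.f i' = U.f i := by rw [b2, a2, d4]
  refine ⟨⟨C.sq_left h3, C.sq_left h4⟩, by rw [b1, a1, c3], hf, ?_⟩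
  have h6 : C.Sq (U.hor i) (C.hcomp κ' (T'.hor (μ (e i).1.2))) :=
    C.sq_vcomp a4 (C.sq_hcomp h3 d5)
  exact C.sq_vcomp h6 (sq_symm b4 (by rw [b2]))

theorem Span.IsComp.assoc {E : SC C} {R : Span D E} {U : Span A D} {V V' : Span A E}
    {W : Span B E} (hU : Span.IsComp S T U) (hV : Span.IsComp U R V) (hW : Span.IsComp T R W)
    (hV' : Span.IsComp S W V') : V ≈ V' := by
  obtain ⟨e, he⟩ := hU
  obtain ⟨d, hd⟩ := hV
  obtain ⟨k, hk⟩ := hW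
  obtain ⟨l, hl⟩ := hV'
  let g : CompIdx U R ≃ CompIdx S W :=
    { toFun := fun z => ⟨((e z.1.1).1.1, k.symm ⟨((e z.1.1).1.2, z.1.2), by
          rw [← (he _).2.1]; exact z.2⟩), by
            rw [(hk _).1, Equiv.apply_symm_apply]; exact (e z.1.1).2⟩
      invFun := fun z => ⟨(e.symm ⟨(z.1.1, (k z.1.2).1.1), by
          rw [← (hk _).1]; exact z.2⟩, (k z.1.2).1.2), by
            rw [(he _).2.1, Equiv.apply_symm_apply]; exact (k z.1.2).2⟩
      left_inv := fun z => by
        obtain ⟨⟨a, b⟩, hz⟩ := z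
        apply Subtype.ext
        apply Prod.ext
        · apply e.injective
          apply Subtype.ext
          simp
        · simp
      right_inv := fun z => by
        obtain ⟨⟨a, b⟩, hz⟩ := z
        apply Subtype.ext
        apply Prod.ext
        · simp
        · apply k.injective
          apply Subtype.ext
          simp }
  have key : ∀ i, ∃ i', l i' = g (d i) ∧ i' = ((d.trans g).trans l.symm) i :=
    fun i => ⟨_, by simp, rfl⟩
  refine ⟨(d.trans g).trans l.symm, fun i => ?_⟩
  obtain ⟨i', h1, h2⟩ := key i
  rw [← h2]
  obtain ⟨a1, a2, κ, a3, a4⟩ := hd i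
  obtain ⟨b1, b2, l', b3, b4⟩ := hl i'
  have hg1 : (g (d i)).1.1 = (e (d i).1.1).1.1 := rfl
  have hg2 : (k (g (d i)).1.2).1 = ((e (d i).1.1).1.2, (d i).1.2) := by simp [g]
  clear_value g
  generalize l i' = z at *
  subst h1
  obtain ⟨c1, c2, κ', c3, c4⟩ := he (d i).1.1
  obtain ⟨d1, d2, μ, d3, d4⟩ := hk (g (d i)).1.2
  generalize g (d i) = z at *
  obtain ⟨⟨s, w⟩, hz⟩ := z
  dsimp only at *
  subst hg1
  generalize k w = y at *
  obtain ⟨⟨t, r⟩, hy⟩ := y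
  obtain ⟨rfl, rfl⟩ := Prod.mk.inj hg2
  dsimp only at *
  have e1 : C.Sq l' κ' := sq_mono b3 c3 (C.sq_left d3)
  have e2 : C.Sq (C.hcomp l' μ) (C.hcomp κ' (T.hor (e (d i).1.1).1.2)) := C.sq_hcomp e1 d3
  have e3 : C.Sq κ (C.hcomp κ' (T.hor (e (d i).1.1).1.2)) := C.sq_vcomp a3 c4
  have e4 : C.Sq κ (C.hcomp l' μ) := C.sq_unique e3 e2
  have e5 : C.Sq (C.hcomp l' μ) κ := C.sq_unique e2 e3
  refine ⟨⟨C.sq_left e4, C.sq_left e5⟩, by rw [b1, a1, c1], by rw [b2, a2, d2], ?_⟩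
  have e6 : C.Sq (V.hor i) (C.hcomp (C.hcomp l' μ) (R.hor (d i).1.2)) :=
    C.sq_vcomp a4 (C.sq_hcomp e4 (C.sq_vid _))
  rw [C.hassoc] at e6
  have e7 : C.Sq (C.hcomp μ (R.hor (d i).1.2)) (W.hor w) := sq_symm d4 (by rw [d2])
  exact C.sq_vcomp (C.sq_vcomp e6 (C.sq_hcomp (C.sq_vid l') e7)) (sq_symm b4 (by rw [b2]))

theorem Span.id_isComp (T : Span A B) : Span.IsComp (Span.id A) T T :=
  ⟨{ toFun := fun i => ⟨(T.p i, i), rfl⟩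
     invFun := fun z => z.1.2
     left_inv := fun _ => rfl
     right_inv := fun z => Subtype.ext (Prod.ext z.2.symm rfl) }, fun i =>
    ⟨rfl, rfl, C.hid _, C.sq_hid (T.sub.le i), by rw [C.hid_comp]; exact C.sq_vid _⟩⟩

theorem Span.isComp_id (S : Span A B) : Span.IsComp S (Span.id B) S :=
  ⟨{ toFun := fun i => ⟨(i, S.f i), rfl⟩
     invFun := fun z => z.1.1
     left_inv := fun _ => rfl
     right_inv := fun z => Subtype.ext (Prod.ext rfl z.2) }, fun i =>
    ⟨rfl, rfl, S.hor i, C.sq_vid _, by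
      have := C.hcomp_id (S.hor i)
      exact this.symm ▸ C.sq_vid _⟩⟩

end Comp

/-- The category `SC(C)`. -/
noncomputable instance : Category (SC C) where
  Hom A B := Quotient (Span.setoid A B)
  id A := Quotient.mk _ (Span.id A)
  comp := Quotient.map₂ Span.comp fun S S' hS T T' hT =>
    (Span.comp_isComp S T).equiv (Span.comp_isComp S' T') hS hT
  id_comp f := Quotient.inductionOn f fun T => Quotient.sound
    ((Span.comp_isComp _ T).equiv (Span.id_isComp T) (Setoid.refl _) (Setoid.refl _))
  comp_id f := Quotient.inductionOn f fun T => Quotient.sound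
    ((Span.comp_isComp T _).equiv (Span.isComp_id T) (Setoid.refl _) (Setoid.refl _))
  assoc f g h := Quotient.inductionOn₃ f g h fun S T R => Quotient.sound
    (Span.IsComp.assoc (Span.comp_isComp S T) (Span.comp_isComp _ R) (Span.comp_isComp T R)
      (Span.comp_isComp S _))

/-- The morphism represented by a diagram. -/
def Span.hom {A B : SC C} (S : Span A B) : A ⟶ B := Quotient.mk _ S

theorem Span.hom_comp {A B D : SC C} {S : Span A B} {T : Span B D} {U : Span A D}
    (h : Span.IsComp S T U) : S.hom ≫ T.hom = U.hom :=
  Quotient.sound ((Span.comp_isComp S T).equiv h (Setoid.refl _) (Setoid.refl _))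

/-- Cofibrations: `p` is a covering sub-map and `σ` has an injective set map. -/
def cof (C : PolytopeComplex.{v, u}) : MorphismProperty (SC C) := fun A B φ =>
  ∃ S : Span A B, S.hom = φ ∧ IsCoveringSubmap S.apex.elt A.elt S.p ∧ Function.Injective S.f

/-- Weak equivalences: `p` is a covering sub-map and `σ` has a bijective set map. -/
def weq (C : PolytopeComplex.{v, u}) : MorphismProperty (SC C) := fun A B φ =>
  ∃ S : Span A B, S.hom = φ ∧ IsCoveringSubmap S.apex.elt A.elt S.p ∧ Function.Bijective S.f

/-- The object `{a}` with a single polytope `a` (indexed by `0`). -/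
noncomputable def single (a : C.Polytope) : SC C where
  val n := if n = 0 then a.1 else C.bot
  finite := (Set.finite_singleton 0).subset fun n hn => by
    by_contra h
    exact hn (if_neg h)

/-! ### Functoriality -/

section Map

variable {D E : PolytopeComplex.{v, u}} (F : C ⟶ D)

/-- `{a_i}_i ↦ {F a_i}_i`; indices with `F a_i` initial disappear from the index set. -/
def mapObj (A : SC C) : SC D where
  val n := F.obj (A.val n)
  finite := A.finite.subset fun n hn h => hn (by rw [h, F.map_bot])

/-- The inclusion of index sets. -/
def idxIncl (A : SC C) (i : (mapObj F A).Idx) : A.Idx :=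
  ⟨i.1, fun h => i.2 (by
    have : F.obj (A.val i.1) = D.bot := by rw [h, F.map_bot]
    exact this)⟩

theorem idxIncl_injective (A : SC C) : Function.Injective (idxIncl F A) := fun _ _ h =>
  Idx.transfer h rfl rfl

/-- The image of a diagram. -/
def mapSpan {A B : SC C} (S : Span A B) : Span (mapObj F A) (mapObj F B) where
  apex := mapObj F S.apex
  p i := ⟨(S.p (idxIncl F _ i)).1, fun h =>
    ne_bot_of_le (F.mono (S.sub.le (idxIncl F _ i))) i.2 h⟩
  sub :=
    { le := fun i => F.mono (S.sub.le (idxIncl F _ i))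
      disjoint := fun i i' h h' => by
        have h1 : S.p (idxIncl F _ i) = S.p (idxIncl F _ i') :=
          Idx.transfer h' rfl rfl
        have h2 := S.sub.disjoint _ _ (fun h'' => h (idxIncl_injective F _ h'')) h1
        have h3 := F.map_pullback (S.sub.le _) (by rw [h1]; exact S.sub.le _) h2
        rw [F.map_bot] at h3
        exact h3 }
  f i := ⟨(S.f (idxIncl F _ i)).1, fun h =>
    i.2 ((eq_bot_iff (F.hmap (S.hor (idxIncl F _ i)))).2 h)⟩
  hor i := F.hmap (S.hor (idxIncl F _ i))

theorem mapSpan_equiv {A B : SC C} {S T : Span A B} (h : S ≈ T) : mapSpan F S ≈ mapSpan F T := by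
  obtain ⟨ι, h⟩ := h
  let g : (mapObj F S.apex).Idx ≃ (mapObj F T.apex).Idx :=
    { toFun := fun i => ⟨(ι (idxIncl F _ i)).1, fun hb =>
        ne_bot_of_le (F.mono (h (idxIncl F _ i)).1.1) i.2 hb⟩
      invFun := fun i => ⟨(ι.symm (idxIncl F _ i)).1, fun hb => by
        have := (h (ι.symm (idxIncl F _ i))).1.2
        rw [Equiv.apply_symm_apply] at this
        exact ne_bot_of_le (F.mono this) i.2 hb⟩
      left_inv := fun i => by
        apply idxIncl_injective
        exact ι.symm_apply_apply _
      right_inv := fun i => by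
        apply idxIncl_injective
        exact ι.apply_symm_apply _ }
  refine ⟨g, fun i => ?_⟩
  obtain ⟨⟨h1, h2⟩, h3, h4, h5⟩ := h (idxIncl F _ i)
  exact ⟨⟨F.mono h1, F.mono h2⟩, Idx.transfer h3 rfl rfl,
    Idx.transfer h4 rfl rfl, F.sq h5⟩

theorem mapSpan_isComp {A B K : SC C} {S : Span A B} {T : Span B K} {U : Span A K}
    (h : Span.IsComp S T U) : Span.IsComp (mapSpan F S) (mapSpan F T) (mapSpan F U) := by
  obtain ⟨e, he⟩ := h
  let g : (mapSpan F U).apex.Idx ≃ CompIdx (mapSpan F S) (mapSpan F T) :=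
    { toFun := fun i => ⟨(⟨(e (idxIncl F _ i)).1.1.1, fun hb => by
          obtain ⟨-, -, κ, h1, -⟩ := he (idxIncl F _ i)
          exact ne_bot_of_le (F.mono (C.sq_left h1)) i.2 hb⟩,
          ⟨(e (idxIncl F _ i)).1.2.1, fun hb => by
          obtain ⟨-, -, κ, h1, -⟩ := he (idxIncl F _ i)
          exact i.2 ((eq_bot_iff (F.hmap κ)).2 hb)⟩),
          Idx.transfer (e (idxIncl F _ i)).2 rfl rfl⟩
      invFun := fun z => ⟨(e.symm ⟨(idxIncl F _ z.1.1, idxIncl F _ z.1.2),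
          Idx.transfer z.2 rfl rfl⟩).1, fun hb => by
          obtain ⟨-, -, κ, h1, -⟩ := he (e.symm ⟨(idxIncl F _ z.1.1, idxIncl F _ z.1.2),
            Idx.transfer z.2 rfl rfl⟩)
          have := (eq_bot_iff (F.hmap κ)).1 hb
          rw [Equiv.apply_symm_apply] at this
          exact z.1.2.2 this⟩
      left_inv := fun i => by
        apply idxIncl_injective
        exact e.symm_apply_apply _
      right_inv := fun z => by
        have key := e.apply_symm_apply ⟨(idxIncl F _ z.1.1, idxIncl F _ z.1.2),
            Idx.transfer z.2 rfl rfl⟩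
        apply Subtype.ext
        apply Prod.ext
        · apply idxIncl_injective
          exact congrArg (fun y => y.1.1) key
        · apply idxIncl_injective
          exact congrArg (fun y => y.1.2) key }
  refine ⟨g, fun i => ?_⟩
  obtain ⟨h1, h2, κ, h3, h4⟩ := he (idxIncl F _ i)
  refine ⟨Idx.transfer h1 rfl rfl, Idx.transfer h2 rfl rfl,
    F.hmap κ, F.sq h3, ?_⟩
  have := F.sq h4
  rw [F.hmap_comp] at this
  exact this

/-- The functor `SC(F) : SC(C) ⥤ SC(D)` induced by a polytope functor `F`. -/
def map : SC C ⥤ SC D where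
  obj := mapObj F
  map := Quotient.map (mapSpan F) fun _ _ => mapSpan_equiv F
  map_id A := Quotient.sound ⟨_root_.Equiv.refl _, fun i =>
    ⟨⟨le_rfl, le_rfl⟩, rfl, rfl, by
      have h := F.hmap_id (A.elt (idxIncl F A i))
      change D.Sq (F.hmap (C.hid (A.elt (idxIncl F A i)))) _
      rw [h]
      exact D.sq_vid _⟩⟩
  map_comp f g := Quotient.inductionOn₂ f g fun S T =>
    (Span.hom_comp (mapSpan_isComp F (Span.comp_isComp S T))).symm

theorem map_id (C : PolytopeComplex.{v, u}) : map (𝟙 C) = 𝟭 (SC C) :=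
  CategoryTheory.Functor.hext (fun _ => rfl) fun _ _ f =>
    heq_of_eq (Quotient.inductionOn f fun _ => rfl)

theorem map_comp (G : D ⟶ E) : map (F ≫ G) = map F ⋙ map G :=
  CategoryTheory.Functor.hext (fun _ => rfl) fun _ _ f =>
    heq_of_eq (Quotient.inductionOn f fun _ => rfl)

end Map

end SC

/-! ## Waldhausen categories -/

section Waldhausen

variable {E : Type u'} [Category.{v'} E]

/-- `E`, with cofibrations `co` and weak equivalences `w`, is a Waldhausen category. -/
structure IsWaldhausen (co w : MorphismProperty E) : Prop where
  hasZero : HasZeroObject E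
  co_mul : co.IsMultiplicative
  w_mul : w.IsMultiplicative
  co_of_iso : ∀ {A B : E} (f : A ⟶ B), IsIso f → co f
  w_of_iso : ∀ {A B : E} (f : A ⟶ B), IsIso f → w f
  co_of_zero : ∀ {Z A : E} (f : Z ⟶ A), IsZero Z → co f
  hasPushout : ∀ {A B X : E} (i : A ⟶ B) (f : A ⟶ X), co i → HasPushout i f
  co_pushout : ∀ {A B X P : E} {i : A ⟶ B} {f : A ⟶ X} {g : B ⟶ P} {j : X ⟶ P},
    IsPushout i f g j → co i → co j
  gluing : ∀ {A B X P A' B' X' P' : E} {i : A ⟶ B} {f : A ⟶ X} {g : B ⟶ P} {j : X ⟶ P}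
    {i' : A' ⟶ B'} {f' : A' ⟶ X'} {g' : B' ⟶ P'} {j' : X' ⟶ P'}
    {a : A ⟶ A'} {b : B ⟶ B'} {x : X ⟶ X'} {t : P ⟶ P'},
    IsPushout i f g j → IsPushout i' f' g' j' → co i → co i' →
    i ≫ b = a ≫ i' → f ≫ x = a ≫ f' → g ≫ t = b ≫ g' → j ≫ t = x ≫ j' →
    w a → w b → w x → w t

/-- `A → B → Q` is a cofibration sequence: `i` is a cofibration and `q` is its cofiber, the pushout
of `i` along `A → 0`. -/
structure IsCofibrationSequence (co : MorphismProperty E) {A B Q : E} (i : A ⟶ B) (q : B ⟶ Q) :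
    Prop where
  co : co i
  cofiber : ∃ (Z : E) (f : A ⟶ Z) (g : Z ⟶ Q), IsZero Z ∧ IsPushout i f q g

/-- The extension axiom. -/
def ExtensionAxiom (co w : MorphismProperty E) : Prop :=
  ∀ {A B Q A' B' Q' : E} {i : A ⟶ B} {q : B ⟶ Q} {i' : A' ⟶ B'} {q' : B' ⟶ Q'}
    {a : A ⟶ A'} {b : B ⟶ B'} {c : Q ⟶ Q'},
    IsCofibrationSequence co i q → IsCofibrationSequence co i' q' →
    i ≫ b = a ≫ i' → q ≫ c = b ≫ q' → w a → w c → w b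

/-- Every cofibration sequence `A → B → Q` has a canonical splitting: there is exactly one section
`s` of `B → Q`; it is a cofibration, and `A ⨿ Q → B` is a weak equivalence. -/
def HasCanonicalSplittings (co w : MorphismProperty E) : Prop :=
  ∀ {A B Q : E} {i : A ⟶ B} {q : B ⟶ Q}, IsCofibrationSequence co i q →
    ∃ s : Q ⟶ B, s ≫ q = 𝟙 Q ∧ (∀ s' : Q ⟶ B, s' ≫ q = 𝟙 Q → s' = s) ∧ co s ∧
      ∀ (c : BinaryCofan A Q) (hc : IsColimit c), w (BinaryCofan.IsColimit.desc hc i s)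

/-- The relations defining `K₀` of a Waldhausen category. -/
inductive K0Rel (co w : MorphismProperty E) : FreeAbelianGroup E → Prop
  | weq {A B : E} (f : A ⟶ B) (hf : w f) :
      K0Rel co w (FreeAbelianGroup.of A - FreeAbelianGroup.of B)
  | cof {A B Q : E} (i : A ⟶ B) (q : B ⟶ Q) (h : IsCofibrationSequence co i q) :
      K0Rel co w (FreeAbelianGroup.of B - (FreeAbelianGroup.of A + FreeAbelianGroup.of Q))

/-- `K₀` of a Waldhausen category: the free abelian group on the objects, modulo `[A] = [B]` for
weak equivalences `A → B` and `[B] = [A] + [B/A]` for cofibration sequences `A → B → B/A`. -/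
abbrev K0 (co w : MorphismProperty E) : Type u' :=
  FreeAbelianGroup E ⧸ AddSubgroup.closure {x | K0Rel co w x}

/-- The class of an object in `K₀`. -/
def K0.of (co w : MorphismProperty E) (A : E) : K0 co w :=
  QuotientAddGroup.mk (FreeAbelianGroup.of A)

/-- Exact functors between Waldhausen categories. -/
structure IsExactFunctor {E' : Type*} [Category* E'] (co w : MorphismProperty E)
    (co' w' : MorphismProperty E') (F : E ⥤ E') : Prop where
  map_zero : ∀ {Z : E}, IsZero Z → IsZero (F.obj Z)
  map_co : ∀ {A B : E} (f : A ⟶ B), co f → co' (F.map f)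
  map_w : ∀ {A B : E} (f : A ⟶ B), w f → w' (F.map f)
  map_pushout : ∀ {A B X P : E} {i : A ⟶ B} {f : A ⟶ X} {g : B ⟶ P} {j : X ⟶ P},
    IsPushout i f g j → co i → IsPushout (F.map i) (F.map f) (F.map g) (F.map j)

end Waldhausen

/-- A category with two distinguished classes of morphisms. -/
structure MarkedCat where
  carrier : Type u'
  [cat : Category.{v'} carrier]
  co : MorphismProperty carrier
  w : MorphismProperty carrier

attribute [instance] MarkedCat.cat

/-- Morphisms of `MarkedCat` are all functors. -/
instance : Category MarkedCat.{v', u'} where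
  Hom X Y := X.carrier ⥤ Y.carrier
  id X := 𝟭 X.carrier
  comp F G := F ⋙ G

/-- A Waldhausen category. -/
structure WaldCat extends MarkedCat.{v', u'} where
  isWaldhausen : IsWaldhausen co w

/-- The category of Waldhausen categories and exact functors. -/
instance : Category WaldCat.{v', u'} where
  Hom X Y := {F : X.carrier ⥤ Y.carrier // IsExactFunctor X.co X.w Y.co Y.w F}
  id X := ⟨𝟭 X.carrier, ⟨fun h => h, fun _ h => h, fun _ h => h, fun h _ => h⟩⟩
  comp F G := ⟨F.1 ⋙ G.1,
    ⟨fun h => G.2.map_zero (F.2.map_zero h), fun _ h => G.2.map_co _ (F.2.map_co _ h),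
      fun _ h => G.2.map_w _ (F.2.map_w _ h),
      fun h hi => G.2.map_pushout (F.2.map_pushout h hi) (F.2.map_co _ hi)⟩⟩

/-- The forgetful functor. -/
def WaldCat.forget : WaldCat.{v', u'} ⥤ MarkedCat.{v', u'} where
  obj X := X.toMarkedCat
  map F := F.1

/-- The assignments `C ↦ SC(C)`, with its cofibrations and weak equivalences, and `F ↦ SC(F)`. -/
noncomputable def SC.functor : PolytopeComplex.{v, u} ⥤ MarkedCat.{max u v, u} where
  obj C := { carrier := SC C, co := SC.cof C, w := SC.weq C }
  map F := SC.map F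
  map_id C := SC.map_id C
  map_comp F G := SC.map_comp F G

/-! ## The scissors congruence group -/

open PolytopeComplex in
/-- The relations `[a] = Σ [a_i]` for covering sub-maps `{a_i} ⇢ {a}` and `[a] = [b]` for
horizontal morphisms `a → b`. -/
inductive ScissorsRel (C : PolytopeComplex.{v, u}) : FreeAbelianGroup C.Polytope → Prop
  | cover {I : Type} [Fintype I] (x : I → C.Polytope) (a : C.Polytope)
      (h : IsCoveringSubmap (fun i => (x i).1) (fun _ : Unit => a.1) (fun _ => ())) :
      ScissorsRel C (FreeAbelianGroup.of a - ∑ i, FreeAbelianGroup.of (x i))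
  | hor (a b : C.Polytope) (σ : C.Hor a.1 b.1) :
      ScissorsRel C (FreeAbelianGroup.of a - FreeAbelianGroup.of b)

/-- The free abelian group on the polytopes, modulo the above relations. -/
abbrev ScissorsGroup (C : PolytopeComplex.{v, u}) : Type u :=
  FreeAbelianGroup C.Polytope ⧸ AddSubgroup.closure {x | ScissorsRel C x}

/-- The class of a polytope. -/
def ScissorsGroup.of {C : PolytopeComplex.{v, u}} (a : C.Polytope) : ScissorsGroup C :=
  QuotientAddGroup.mk (FreeAbelianGroup.of a)

/-! Morphisms of `SC(C)` are handled through their germs: a germ of `φ : A ⟶ B` from `i` to `j` is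
a horizontal morphism `y → y'`, with `y ⇢ a_i` and `y' ⇢ b_j`, obtained by restricting a component
of a diagram representing `φ`.  A morphism is determined by its germs and germs compose.
Cofibrations are the morphisms that are defined locally everywhere and injective on germs, and weak
equivalences are those which moreover hit every index.  The axioms thereby become statements about
partial injections that are verified locally for the topology.

Up to a weak equivalence, a cofibration `A → B` is the inclusion of `A` into the disjoint union of
`A` and the members of `B` which are not hit, and the pushout of such an inclusion is again a
disjoint union.  The pushout of a weak equivalence `A → B` along `f : A → X` is the largest
refinement of `X` whose pieces have preimages, under every component of `f`, contained in a single
member of the cover of `A`; polytope functors preserve it because they preserve pullbacks.  In the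
cofiber only the members which are not hit remain, so `B → B/A` is a coordinate projection, split by
the inclusion.  Splitting off one member at a time, the class of a family in `K₀` is the sum of the
classes of its members, and the inverse of `[a] ↦ [{a}]` sends the class of `{a_i}` to `∑ [a_i]`. -/

theorem isGLB_pair_iff {X : Type*} [Preorder X] {a b d : X} :
    IsGLB {a, b} d ↔ ∀ c, c ≤ d ↔ c ≤ a ∧ c ≤ b := by
  simp [isGLB_iff_le_iff, lowerBounds_insert]

/-! ### Properties holding locally -/

section HoldsLocally

variable {X : Type u} [Preorder X] {J : GrothendieckTopology X} {a b : X} {P Q : X → Prop}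

/-- The property `P` holds locally on `a`: it holds for all members of some covering sieve.  This is
the form in which covering families are used, since it does not mention an index type. -/
def HoldsLocally (J : GrothendieckTopology X) (a : X) (P : X → Prop) : Prop :=
  ∃ S ∈ J a, ∀ b (h : b ≤ a), S (homOfLE h) → P b

namespace HoldsLocally

theorem mono (h : HoldsLocally J a P) (hPQ : ∀ b ≤ a, P b → Q b) : HoldsLocally J a Q := by
  obtain ⟨S, hS, hP⟩ := h
  exact ⟨S, hS, fun b hb hSb => hPQ b hb (hP b hb hSb)⟩

theorem of_forall (h : ∀ b ≤ a, P b) : HoldsLocally J a P :=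
  ⟨⊤, J.top_mem a, fun b hb _ => h b hb⟩

theorem of_le (h : HoldsLocally J a P) (hb : b ≤ a) : HoldsLocally J b P := by
  obtain ⟨S, hS, hP⟩ := h
  exact ⟨S.pullback (homOfLE hb), J.pullback_stable _ hS, fun c hc => hP c (hc.trans hb)⟩

theorem and (hP : HoldsLocally J a P) (hQ : HoldsLocally J a Q) :
    HoldsLocally J a fun b => P b ∧ Q b := by
  obtain ⟨S, hS, hP⟩ := hP
  obtain ⟨T, hT, hQ⟩ := hQ
  exact ⟨S ⊓ T, J.intersection_covering hS hT, fun b hb hST => ⟨hP b hb hST.1, hQ b hb hST.2⟩⟩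

theorem forall_of_finite {ι : Type*} [Finite ι] {R : ι → X → Prop}
    (h : ∀ i, HoldsLocally J a (R i)) : HoldsLocally J a fun b => ∀ i, R i b := by
  classical
  cases nonempty_fintype ι
  suffices key : ∀ s : Finset ι, HoldsLocally J a fun b => ∀ i ∈ s, R i b from
    (key Finset.univ).mono fun b _ hb i => hb i (Finset.mem_univ i)
  intro s
  induction s using Finset.induction_on with
  | empty => exact of_forall fun b _ i hi => absurd hi (Finset.notMem_empty i)
  | insert i s _ ih =>
    exact ((h i).and ih).mono fun b _ hb => Finset.forall_mem_insert .. |>.2 hb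

theorem trans (h : HoldsLocally J a P) (hPQ : ∀ b ≤ a, P b → HoldsLocally J b Q) :
    HoldsLocally J a Q := by
  obtain ⟨S, hS, hP⟩ := h
  let T : Sieve a :=
    { arrows := fun b _ => ∀ c ≤ b, Q c
      downward_closed := fun hb g c hc => hb c (hc.trans (leOfHom g)) }
  refine ⟨T, J.transitive hS T fun b f hf => ?_, fun b _ hT => hT b le_rfl⟩
  obtain ⟨R, hR, hQ⟩ := hPQ b (leOfHom f) (hP b (leOfHom f) hf)
  refine J.superset_covering (fun c g hg d hd => ?_) hR
  exact hQ d (hd.trans (leOfHom g)) (R.downward_closed hg (homOfLE hd))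

theorem exists_isCoveringFamily (h : HoldsLocally J a P) :
    ∃ (ι : Type u) (x : ι → X), IsCoveringFamily J x a ∧ ∀ i, P (x i) := by
  obtain ⟨S, hS, hP⟩ := h
  refine ⟨{b : X // ∃ h : b ≤ a, S (homOfLE h)}, Subtype.val, ⟨fun b => b.2.1, ?_⟩,
    fun b => hP b.1 b.2.1 b.2.2⟩
  refine J.superset_covering (fun b f hf => ?_) hS
  exact ⟨b, 𝟙 b, f, Presieve.ofArrows.mk (⟨b, leOfHom f, hf⟩ : {b : X // _}), rfl⟩

end HoldsLocally

theorem isCoveringFamily_iff {ι : Type w} {x : ι → X} :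
    IsCoveringFamily J x a ↔ (∀ i, x i ≤ a) ∧ HoldsLocally J a fun b => ∃ i, b ≤ x i := by
  constructor
  · rintro ⟨h, hS⟩
    refine ⟨h, _, hS, ?_⟩
    rintro b hb ⟨_, g, _, ⟨i⟩, -⟩
    exact ⟨i, leOfHom g⟩
  · rintro ⟨h, S, hS, hP⟩
    refine ⟨h, J.superset_covering (fun b f hf => ?_) hS⟩
    obtain ⟨i, hi⟩ := hP b (leOfHom f) hf
    exact ⟨x i, homOfLE hi, homOfLE (h i), Presieve.ofArrows.mk i, rfl⟩

end HoldsLocally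

namespace PolytopeComplex

variable {C : PolytopeComplex.{v, u}}

/-! ### Squares -/

section Squares

variable {a b c d x y z a₁ b₁ a₂ b₂ : C.Ob}

theorem hinv_hinv (σ : C.Hor a b) : C.hinv (C.hinv σ) = σ := by
  rw [← C.hcomp_id (C.hinv (C.hinv σ)), ← C.hinv_comp σ, ← C.hassoc, C.hinv_comp, C.hid_comp]

theorem hcomp_hinv_cancel (σ : C.Hor a b) (τ : C.Hor a c) :
    C.hcomp σ (C.hcomp (C.hinv σ) τ) = τ := by
  rw [← C.hassoc, C.hcomp_inv, C.hid_comp]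

theorem hinv_hcomp_cancel (σ : C.Hor a b) (τ : C.Hor b c) :
    C.hcomp (C.hinv σ) (C.hcomp σ τ) = τ := by
  rw [← C.hassoc, C.hinv_comp, C.hid_comp]

theorem right_ne_bot (σ : C.Hor a b) (h : a ≠ C.bot) : b ≠ C.bot :=
  (eq_bot_iff σ).not.1 h

theorem left_ne_bot (σ : C.Hor a b) (h : b ≠ C.bot) : a ≠ C.bot :=
  (eq_bot_iff σ).not.2 h

theorem sq_hinv {σ : C.Hor a b} {τ : C.Hor c d} (h : C.Sq σ τ) :
    C.Sq (C.hinv σ) (C.hinv τ) := by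
  obtain ⟨b₁, ρ, hρ⟩ := C.exists_sq (C.hinv τ) (C.sq_left h)
  have hρσ : C.Sq (C.hcomp ρ σ) (C.hid d) := C.hinv_comp τ ▸ C.sq_hcomp hρ h
  have hσρ := C.sq_hcomp (C.sq_unique (C.sq_hid (C.sq_right h)) hρσ) (C.sq_vid (C.hinv σ))
  rw [C.hid_comp, C.hassoc, C.hcomp_inv, C.hcomp_id] at hσρ
  exact C.sq_vcomp hσρ hρ

theorem sq_hinv_left {σ : C.Hor a b} {τ : C.Hor d c} (h : C.Sq σ (C.hinv τ)) :
    C.Sq (C.hinv σ) τ :=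
  hinv_hinv τ ▸ sq_hinv h

theorem exists_sq_of_le_left (σ : C.Hor a b) (h : x ≤ a) :
    ∃ (y : C.Ob) (τ : C.Hor x y), C.Sq τ σ := by
  obtain ⟨y, τ, hτ⟩ := C.exists_sq (C.hinv σ) h
  exact ⟨y, C.hinv τ, sq_hinv_left hτ⟩

theorem sq_of_left_le {σ : C.Hor a b} {τ₁ : C.Hor a₁ b₁} {τ₂ : C.Hor a₂ b₂}
    (h₁ : C.Sq τ₁ σ) (h₂ : C.Sq τ₂ σ) (h : a₁ ≤ a₂) : C.Sq τ₁ τ₂ :=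
  sq_mono h₁ h₂ ((C.sq_le_iff h₁ h₂).1 h)

theorem sq_of_sq_hcomp_left {σ : C.Hor a b} {τ : C.Hor b c} {σ' : C.Hor x y} {τ' : C.Hor y z}
    (hσ : C.Sq σ σ') (h : C.Sq (C.hcomp σ τ) (C.hcomp σ' τ')) : C.Sq τ τ' := by
  have := C.sq_hcomp (sq_hinv hσ) h
  rwa [hinv_hcomp_cancel, hinv_hcomp_cancel] at this

theorem exists_sq_hcomp {σ : C.Hor a b} {ρ : C.Hor b c} {τ : C.Hor x z}
    (h : C.Sq τ (C.hcomp σ ρ)) :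
    ∃ (y : C.Ob) (τ₁ : C.Hor x y) (τ₂ : C.Hor y z),
      C.hcomp τ₁ τ₂ = τ ∧ C.Sq τ₁ σ ∧ C.Sq τ₂ ρ := by
  obtain ⟨y, τ₂, hτ₂⟩ := C.exists_sq ρ (C.sq_right h)
  obtain ⟨x', τ₁', hτ₁'⟩ := C.exists_sq σ (C.sq_left hτ₂)
  have hτ₁ := C.sq_hcomp (C.sq_unique h (C.sq_hcomp hτ₁' hτ₂)) (C.sq_vid (C.hinv τ₂))
  rw [C.hassoc τ₁', C.hcomp_inv, C.hcomp_id] at hτ₁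
  exact ⟨y, C.hcomp τ (C.hinv τ₂), τ₂, by rw [C.hassoc, C.hinv_comp, C.hcomp_id],
    C.sq_vcomp hτ₁ hτ₁', hτ₂⟩

end Squares

/-! ### Coverings in a polytope complex -/

theorem exists_ne_bot_of_holdsLocally {a : C.Ob} {P : C.Ob → Prop} (h : HoldsLocally C.J a P)
    (ha : a ≠ C.bot) : ∃ b ≤ a, b ≠ C.bot ∧ P b := by
  obtain ⟨ι, x, hx, hP⟩ := h.exists_isCoveringFamily
  by_contra! hne
  refine ha (C.nondegenerate hx fun i => ?_)
  by_contra hi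
  exact hne _ ((isCoveringFamily_iff.1 hx).1 i) hi (hP i)

theorem holdsLocally_of_ne_bot {a : C.Ob} {P : C.Ob → Prop} (ha : a ≠ C.bot)
    (hP : ∀ b c, b ≤ c → P c → P b) (h : HoldsLocally C.J a fun b => b ≠ C.bot → P b) :
    HoldsLocally C.J a P := by
  obtain ⟨c, -, hc, hPc⟩ := exists_ne_bot_of_holdsLocally h ha
  refine h.mono fun b _ hb => ?_
  by_cases hbot : b = C.bot
  · exact hP b c (hbot ▸ C.bot_le c) (hPc hc)
  · exact hb hbot

theorem holdsLocally_pull {a b : C.Ob} {P : C.Ob → Prop} (h : HoldsLocally C.J b P)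
    (σ : C.Hor a b) :
    HoldsLocally C.J a fun y =>
      ∃ (y' : C.Ob) (τ : C.Hor y y'), C.Sq τ σ ∧ ∃ z, y' ≤ z ∧ P z := by
  obtain ⟨ι, z, hz, hP⟩ := h.exists_isCoveringFamily
  choose x τ hτ using fun i => C.exists_sq σ ((isCoveringFamily_iff.1 hz).1 i)
  refine (isCoveringFamily_iff.1 (C.cover_pull σ τ hτ hz)).2.mono fun y _ ⟨i, hi⟩ => ?_
  obtain ⟨y', ρ, hρ⟩ := exists_sq_of_le_left (τ i) hi
  exact ⟨y', ρ, C.sq_vcomp hρ (hτ i), z i, C.sq_right hρ, hP i⟩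

end PolytopeComplex

-- `PolytopeFunctor.map_cover` concerns index types in the universe of the objects, whereas the
-- index sets of families live in `Type`.
theorem PolytopeFunctor.isCoveringFamily {C D : PolytopeComplex.{v, u}} (F : PolytopeFunctor C D)
    {ι : Type} {x : ι → C.Ob} {a : C.Ob} (h : IsCoveringFamily C.J x a) :
    IsCoveringFamily D.J (fun i => F.obj (x i)) (F.obj a) := by
  obtain ⟨hle, hx⟩ := isCoveringFamily_iff.1 h
  have hlift : IsCoveringFamily C.J (fun i : ULift.{u} ι => x i.down) a :=
    isCoveringFamily_iff.2 ⟨fun i => hle i.down, hx.mono fun b _ ⟨i, hi⟩ => ⟨⟨i⟩, hi⟩⟩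
  exact isCoveringFamily_iff.2 ⟨fun i => F.mono (hle i),
    (isCoveringFamily_iff.1 (F.map_cover hlift)).2.mono fun b _ ⟨i, hi⟩ => ⟨i.down, hi⟩⟩

namespace SC

open PolytopeComplex

variable {C : PolytopeComplex.{v, u}}

/-! ### Germs of morphisms -/

theorem elt_ne_bot (A : SC C) (i : A.Idx) : A.elt i ≠ C.bot := i.2

/-- `τ : y → y'` is a germ of the diagram `S` from `i` to `j`: a restriction of a component of `S`
which goes from the `i`-th member of `A` to the `j`-th member of `B`. -/
def Span.IsGerm {A B : SC C} (S : Span A B) (i : A.Idx) (j : B.Idx) {y y' : C.Ob}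
    (τ : C.Hor y y') : Prop :=
  ∃ s, S.p s = i ∧ S.f s = j ∧ C.Sq τ (S.hor s)

theorem Span.isGerm_hor {A B : SC C} (S : Span A B) (s : S.apex.Idx) :
    S.IsGerm (S.p s) (S.f s) (S.hor s) :=
  ⟨s, rfl, rfl, C.sq_vid _⟩

theorem Span.IsGerm.of_equiv {A B : SC C} {S T : Span A B} {i : A.Idx} {j : B.Idx} {y y' : C.Ob}
    {τ : C.Hor y y'} (h : S.IsGerm i j τ) (hST : S ≈ T) : T.IsGerm i j τ := by
  obtain ⟨ι, hι⟩ := hST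
  obtain ⟨s, rfl, rfl, hs⟩ := h
  obtain ⟨-, hp, hf, hsq⟩ := hι s
  exact ⟨ι s, hp, hf, C.sq_vcomp hs hsq⟩

theorem Span.eq_of_le {A B : SC C} (S : Span A B) {s s' : S.apex.Idx} (h : S.p s = S.p s')
    {w : C.Ob} (hw : w ≠ C.bot) (hs : w ≤ S.apex.elt s) (hs' : w ≤ S.apex.elt s') : s = s' := by
  by_contra hne
  exact hw (isGLB_bot_iff.1 (S.sub.disjoint s s' hne h) w hs hs')

-- Sending a component of `S` to the component of `T` of which it is a germ, and vice versa, yields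
-- inverse bijections: by disjointness a component is a restriction of itself only.
theorem Span.equiv_of_isGerm_iff {A B : SC C} {S T : Span A B}
    (h : ∀ (i : A.Idx) (j : B.Idx) (y y' : C.Ob) (τ : C.Hor y y'), y ≠ C.bot →
      (S.IsGerm i j τ ↔ T.IsGerm i j τ)) : S ≈ T := by
  choose f hfp hff hf using fun s =>
    (h _ _ _ _ (S.hor s) (S.apex.elt_ne_bot s)).1 (S.isGerm_hor s)
  choose g hgp _ hg using fun t =>
    (h _ _ _ _ (T.hor t) (T.apex.elt_ne_bot t)).2 (T.isGerm_hor t)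
  have g_f : ∀ s, g (f s) = s := fun s => (S.eq_of_le (by rw [hgp, hfp]) (S.apex.elt_ne_bot s)
    le_rfl ((C.sq_left (hf s)).trans (C.sq_left (hg _)))).symm
  have f_g : ∀ t, f (g t) = t := fun t => (T.eq_of_le (by rw [hfp, hgp]) (T.apex.elt_ne_bot t)
    le_rfl ((C.sq_left (hg t)).trans (C.sq_left (hf _)))).symm
  refine ⟨⟨f, g, g_f, f_g⟩, fun s => ⟨⟨C.sq_left (hf s), ?_⟩, hfp s, hff s, hf s⟩⟩
  have := C.sq_left (hg (f s))
  rwa [g_f] at this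

/-- `τ : y → y'` is a germ of the morphism `φ` of `SC(C)` from `i` to `j`, i.e. a germ of any
diagram representing `φ`. -/
def IsGerm {A B : SC C} (φ : A ⟶ B) (i : A.Idx) (j : B.Idx) {y y' : C.Ob} (τ : C.Hor y y') :
    Prop :=
  Quotient.liftOn φ (fun S : Span A B => S.IsGerm i j τ) fun _ _ h =>
    propext ⟨fun hS => hS.of_equiv h, fun hT => hT.of_equiv (Setoid.symm h)⟩

theorem exists_span {A B : SC C} (φ : A ⟶ B) : ∃ S : Span A B, S.hom = φ :=
  Quotient.exists_rep φ

theorem hom_ext {A B : SC C} {φ ψ : A ⟶ B}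
    (h : ∀ (i : A.Idx) (j : B.Idx) (y y' : C.Ob) (τ : C.Hor y y'), y ≠ C.bot →
      (IsGerm φ i j τ ↔ IsGerm ψ i j τ)) : φ = ψ := by
  obtain ⟨S, rfl⟩ := exists_span φ
  obtain ⟨T, rfl⟩ := exists_span ψ
  exact Quotient.sound (Span.equiv_of_isGerm_iff h)

section Germs

variable {A B D : SC C} {φ φ' : A ⟶ B} {ψ ψ' : B ⟶ D} {i i' : A.Idx} {j j' : B.Idx} {k : D.Idx}
  {y y' z z' x : C.Ob} {τ : C.Hor y y'} {τ' : C.Hor z z'}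

theorem IsGerm.restrict (h : IsGerm φ i j τ) (hsq : C.Sq τ' τ) : IsGerm φ i j τ' := by
  obtain ⟨S, rfl⟩ := exists_span φ
  obtain ⟨s, hp, hf, hs⟩ := h
  exact ⟨s, hp, hf, C.sq_vcomp hsq hs⟩

theorem IsGerm.exists_component (h : IsGerm φ i j τ) :
    ∃ (a : C.Ob) (ρ : C.Hor a (B.elt j)), IsGerm φ i j ρ ∧ C.Sq τ ρ := by
  obtain ⟨S, rfl⟩ := exists_span φ
  obtain ⟨s, rfl, rfl, hs⟩ := h
  exact ⟨_, S.hor s, S.isGerm_hor s, hs⟩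

theorem IsGerm.le_left (h : IsGerm φ i j τ) : y ≤ A.elt i := by
  obtain ⟨S, rfl⟩ := exists_span φ
  obtain ⟨s, rfl, rfl, hs⟩ := h
  exact (C.sq_left hs).trans (S.sub.le s)

theorem IsGerm.le_right (h : IsGerm φ i j τ) : y' ≤ B.elt j := by
  obtain ⟨a, ρ, -, hsq⟩ := h.exists_component
  exact C.sq_right hsq

theorem IsGerm.exists_common_component (h : IsGerm φ i j τ) (h' : IsGerm φ i j' τ') {w : C.Ob}
    (hw : w ≠ C.bot) (hwy : w ≤ y) (hwz : w ≤ z) :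
    j = j' ∧ ∃ (a : C.Ob) (ρ : C.Hor a (B.elt j)), C.Sq τ ρ ∧ C.Sq τ' ρ := by
  obtain ⟨S, rfl⟩ := exists_span φ
  obtain ⟨s, rfl, rfl, hs⟩ := h
  obtain ⟨s', hp, rfl, hs'⟩ := h'
  obtain rfl := S.eq_of_le hp.symm hw (hwy.trans (C.sq_left hs)) (hwz.trans (C.sq_left hs'))
  exact ⟨rfl, _, S.hor s, hs, hs'⟩

theorem IsGerm.unique {τ' : C.Hor y z} (h : IsGerm φ i j τ) (h' : IsGerm φ i j' τ')
    (hy : y ≠ C.bot) : j = j' ∧ C.Sq τ τ' ∧ C.Sq τ' τ := by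
  obtain ⟨rfl, a, ρ, hρ, hρ'⟩ := h.exists_common_component h' hy le_rfl le_rfl
  exact ⟨rfl, sq_of_left_le hρ hρ' le_rfl, sq_of_left_le hρ' hρ le_rfl⟩

theorem IsGerm.comp {τ' : C.Hor y' z} (h : IsGerm φ i j τ) (h' : IsGerm ψ j k τ') :
    IsGerm (φ ≫ ψ) i k (C.hcomp τ τ') := by
  obtain ⟨S, rfl⟩ := exists_span φ
  obtain ⟨T, rfl⟩ := exists_span ψ
  have hU := Span.comp_isComp S T
  rw [Span.hom_comp hU]
  obtain ⟨s, rfl, rfl, hs⟩ := h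
  obtain ⟨t, hpt, rfl, ht⟩ := h'
  obtain ⟨e, he⟩ := hU
  obtain ⟨r, hr⟩ := e.surjective ⟨(s, t), hpt.symm⟩
  have her := he r
  have hfr := (he r).2.1
  rw [hr] at her hfr
  obtain ⟨hp, hf, κ, hκ, hhor⟩ := her
  exact ⟨r, hp, hf, C.sq_vcomp (C.sq_hcomp (sq_mono hs hκ (C.sq_left ht)) ht)
    (sq_symm hhor (by rw [hfr]))⟩

theorem IsGerm.of_comp (h : IsGerm (φ ≫ ψ) i k τ) :
    ∃ (j : B.Idx) (x : C.Ob) (τ₁ : C.Hor y x) (τ₂ : C.Hor x y'),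
      C.hcomp τ₁ τ₂ = τ ∧ IsGerm φ i j τ₁ ∧ IsGerm ψ j k τ₂ := by
  obtain ⟨S, rfl⟩ := exists_span φ
  obtain ⟨T, rfl⟩ := exists_span ψ
  have hU := Span.comp_isComp S T
  rw [Span.hom_comp hU] at h
  obtain ⟨r, rfl, rfl, hr⟩ := h
  obtain ⟨e, he⟩ := hU
  obtain ⟨hp, hf, κ, hκ, hhor⟩ := he r
  obtain ⟨x, τ₁, τ₂, hτ, hτ₁, hτ₂⟩ := exists_sq_hcomp (C.sq_vcomp hr hhor)
  exact ⟨_, x, τ₁, τ₂, hτ, ⟨_, hp.symm, rfl, C.sq_vcomp hτ₁ hκ⟩, ⟨_, (e r).2.symm, hf.symm, hτ₂⟩⟩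

theorem isGerm_id_iff {i' : A.Idx} :
    IsGerm (𝟙 A) i i' τ ↔ i = i' ∧ C.Sq τ (C.hid (A.elt i)) := by
  constructor
  · rintro ⟨s, rfl, rfl, h⟩
    exact ⟨rfl, h⟩
  · rintro ⟨rfl, h⟩
    exact ⟨i, rfl, rfl, h⟩

theorem isGerm_id_hid (hy : y ≤ A.elt i) : IsGerm (𝟙 A) i i (C.hid y) :=
  isGerm_id_iff.2 ⟨rfl, C.sq_hid hy⟩

/-! ### Totality, injectivity and image -/

/-- `φ` is defined on the subobject `y` of the `i`-th member of its source: `y` is the source of a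
germ, i.e. it is contained in a single component. -/
def DefinedOn (φ : A ⟶ B) (i : A.Idx) (y : C.Ob) : Prop :=
  ∃ (j : B.Idx) (y' : C.Ob) (τ : C.Hor y y'), IsGerm φ i j τ

/-- The index `j` of the target is hit by a component of `φ`. -/
def InImage (φ : A ⟶ B) (j : B.Idx) : Prop :=
  ∃ (i : A.Idx) (y y' : C.Ob) (τ : C.Hor y y'), IsGerm φ i j τ

/-- `φ` is defined locally everywhere on the `i`-th member of its source.  For all `i` together this
says that the sub-map of a representing diagram is covering. -/
def TotalAt (φ : A ⟶ B) (i : A.Idx) : Prop := HoldsLocally C.J (A.elt i) (DefinedOn φ i)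

/-- Germs of `φ` into the `j`-th member of its target are determined by their targets, i.e. at most
one component of `φ` maps to `j`. -/
def InjAt (φ : A ⟶ B) (j : B.Idx) : Prop :=
  ∀ ⦃i i' : A.Idx⦄ ⦃y z x : C.Ob⦄ ⦃τ : C.Hor y x⦄ ⦃τ' : C.Hor z x⦄, x ≠ C.bot →
    IsGerm φ i j τ → IsGerm φ i' j τ' → i = i' ∧ C.Sq τ τ'

theorem IsGerm.definedOn (h : IsGerm φ i j τ) : DefinedOn φ i y := ⟨_, _, _, h⟩

theorem IsGerm.inImage (h : IsGerm φ i j τ) : InImage φ j := ⟨_, _, _, _, h⟩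

theorem DefinedOn.of_le (h : DefinedOn φ i y) (hz : z ≤ y) : DefinedOn φ i z := by
  obtain ⟨j, y', τ, hτ⟩ := h
  obtain ⟨z', ρ, hρ⟩ := exists_sq_of_le_left τ hz
  exact (hτ.restrict hρ).definedOn

theorem DefinedOn.of_comp (h : DefinedOn (φ ≫ ψ) i y) : DefinedOn φ i y := by
  obtain ⟨k, y', τ, hτ⟩ := h
  obtain ⟨j, x, τ₁, τ₂, -, hτ₁, -⟩ := hτ.of_comp
  exact hτ₁.definedOn

theorem InImage.exists_isGerm (h : InImage φ j) (hx : x ≤ B.elt j) :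
    ∃ (i : A.Idx) (y : C.Ob) (τ : C.Hor y x), IsGerm φ i j τ := by
  obtain ⟨i, y, y', τ, hτ⟩ := h
  obtain ⟨a, ρ, hρ, -⟩ := hτ.exists_component
  obtain ⟨z, κ, hκ⟩ := C.exists_sq ρ hx
  exact ⟨i, z, κ, hρ.restrict hκ⟩

theorem InImage.of_comp (h : InImage (φ ≫ ψ) k) : InImage ψ k := by
  obtain ⟨i, y, y', τ, hτ⟩ := h
  obtain ⟨j, x, τ₁, τ₂, -, -, hτ₂⟩ := hτ.of_comp
  exact hτ₂.inImage

theorem InImage.comp (h : InImage φ j) (hτ : IsGerm ψ j k τ) : InImage (φ ≫ ψ) k := by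
  obtain ⟨i, z, ρ, hρ⟩ := h.exists_isGerm hτ.le_left
  exact (hρ.comp hτ).inImage

theorem inImage_id (i : A.Idx) : InImage (𝟙 A) i := (isGerm_id_hid le_rfl).inImage

theorem InImage.isGerm_of_comp_eq (hj : InImage φ j) (h : φ ≫ ψ = φ ≫ ψ') (hy : y ≠ C.bot)
    (hτ : IsGerm ψ j k τ) : IsGerm ψ' j k τ := by
  obtain ⟨i, w, ρ, hρ⟩ := hj.exists_isGerm hτ.le_left
  obtain ⟨j', x, ρ', τ', hcomp, hρ', hτ'⟩ := (h ▸ hρ.comp hτ).of_comp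
  obtain ⟨rfl, hsq, -⟩ := hρ.unique hρ' (left_ne_bot ρ hy)
  exact hτ'.restrict (sq_of_sq_hcomp_left hsq (hcomp ▸ C.sq_vid _))

theorem totalAt_id (i : A.Idx) : TotalAt (𝟙 A) i :=
  HoldsLocally.of_forall fun _ hb => (isGerm_id_hid hb).definedOn

theorem TotalAt.of_comp (h : TotalAt (φ ≫ ψ) i) : TotalAt φ i :=
  HoldsLocally.mono h fun _ _ => DefinedOn.of_comp

theorem TotalAt.holdsLocally_pull (h : TotalAt φ i) (σ : C.Hor y z) (hz : z ≤ A.elt i) :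
    HoldsLocally C.J y fun w => ∃ (w' : C.Ob) (κ : C.Hor w w'), C.Sq κ σ ∧ DefinedOn φ i w' :=
  (PolytopeComplex.holdsLocally_pull (h.of_le hz) σ).mono
    fun _ _ ⟨w', κ, hκ, _, hle, hd⟩ => ⟨w', κ, hκ, hd.of_le hle⟩

theorem TotalAt.comp (h : TotalAt φ i)
    (hψ : ∀ (j : B.Idx) (y y' : C.Ob) (τ : C.Hor y y'), IsGerm φ i j τ → TotalAt ψ j) :
    TotalAt (φ ≫ ψ) i := by
  refine HoldsLocally.trans h ?_
  rintro y - ⟨j, y', τ, hτ⟩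
  refine ((hψ j y y' τ hτ).holdsLocally_pull τ hτ.le_right).mono ?_
  rintro w - ⟨w', ρ, hρ, k, x, κ, hκ⟩
  exact ((hτ.restrict hρ).comp hκ).definedOn

theorem InImage.totalAt (hj : InImage φ j)
    (h : ∀ (i : A.Idx) (y y' : C.Ob) (τ : C.Hor y y'), IsGerm φ i j τ → TotalAt (φ ≫ ψ) i) :
    TotalAt ψ j := by
  obtain ⟨i, y, τ, hτ⟩ := hj.exists_isGerm le_rfl
  refine holdsLocally_of_ne_bot (B.elt_ne_bot j) (fun b c hbc hc => hc.of_le hbc) ?_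
  refine ((h i _ _ τ hτ).holdsLocally_pull (C.hinv τ) hτ.le_left).mono ?_
  rintro w - ⟨w', κ, hκ, k, x, ρ, hρ⟩ hw
  obtain ⟨j', x', ρ₁, ρ₂, rfl, hρ₁, hρ₂⟩ := hρ.of_comp
  obtain ⟨rfl, hsq, -⟩ := (hτ.restrict (sq_hinv_left hκ)).unique hρ₁ (right_ne_bot κ hw)
  exact hρ₂.definedOn.of_le (C.sq_right hsq)

theorem injAt_id (j : A.Idx) : InjAt (𝟙 A) j := by
  rintro i i' y z x τ τ' - h h'
  obtain ⟨rfl, hsq⟩ := isGerm_id_iff.1 h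
  obtain ⟨rfl, hsq'⟩ := isGerm_id_iff.1 h'
  exact ⟨rfl, C.sq_unique hsq hsq'⟩

theorem InjAt.sq_of_le (h : InjAt φ j) (hτ : IsGerm φ i j τ) (hτ' : IsGerm φ i' j τ')
    (hle : y' ≤ z') (hy : y' ≠ C.bot) : i = i' ∧ C.Sq τ τ' := by
  obtain ⟨w, ρ, hρ⟩ := C.exists_sq τ' hle
  obtain ⟨rfl, hsq⟩ := h hy hτ (hτ'.restrict hρ)
  exact ⟨rfl, C.sq_vcomp hsq hρ⟩

theorem InjAt.comp (hφ : ∀ j, InjAt φ j) (hψ : InjAt ψ k) : InjAt (φ ≫ ψ) k := by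
  rintro i i' y z x τ τ' hx hτ hτ'
  obtain ⟨j, x₁, τ₁, τ₂, rfl, hτ₁, hτ₂⟩ := hτ.of_comp
  obtain ⟨j', x₁', τ₁', τ₂', rfl, hτ₁', hτ₂'⟩ := hτ'.of_comp
  obtain ⟨rfl, hsq₂⟩ := hψ hx hτ₂ hτ₂'
  obtain ⟨rfl, hsq₁⟩ := (hφ j).sq_of_le hτ₁ hτ₁' (C.sq_left hsq₂) (left_ne_bot τ₂ hx)
  exact ⟨rfl, C.sq_hcomp hsq₁ hsq₂⟩

theorem InjAt.of_comp (h : ∀ k, InjAt (φ ≫ ψ) k) (hψ : TotalAt ψ j) : InjAt φ j := by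
  rintro i i' y z x τ τ' hx hτ hτ'
  obtain ⟨w, hwx, hw, k, w', κ, hκ⟩ :=
    exists_ne_bot_of_holdsLocally (HoldsLocally.of_le hψ hτ.le_right) hx
  obtain ⟨u, ρ, hρ⟩ := C.exists_sq τ hwx
  obtain ⟨u', ρ', hρ'⟩ := C.exists_sq τ' hwx
  obtain ⟨rfl, hsq⟩ :=
    h k (right_ne_bot κ hw) ((hτ.restrict hρ).comp hκ) ((hτ'.restrict hρ').comp hκ)
  obtain ⟨-, a, σ, hτσ, hτ'σ⟩ := hτ.exists_common_component hτ' (left_ne_bot ρ hw) (C.sq_left hρ)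
    ((C.sq_left hsq).trans (C.sq_left hρ'))
  exact ⟨rfl, C.sq_unique hτσ hτ'σ⟩

theorem InjAt.sq_of_inImage (h : InjAt (φ ≫ ψ) k) (hj : InImage φ j) (hj' : InImage φ j')
    {τ : C.Hor y x} {τ' : C.Hor z x} (hx : x ≠ C.bot) (hτ : IsGerm ψ j k τ)
    (hτ' : IsGerm ψ j' k τ') : j = j' ∧ C.Sq τ τ' := by
  obtain ⟨i, w, ρ, hρ⟩ := hj.exists_isGerm hτ.le_left
  obtain ⟨i', w', ρ', hρ'⟩ := hj'.exists_isGerm hτ'.le_left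
  obtain ⟨rfl, hsq⟩ := h hx (hρ.comp hτ) (hρ'.comp hτ')
  obtain ⟨rfl, a, σ, hρσ, hρ'σ⟩ := hρ.exists_common_component hρ'
    (left_ne_bot ρ (left_ne_bot τ hx)) le_rfl (C.sq_left hsq)
  exact ⟨rfl, sq_of_sq_hcomp_left (sq_of_left_le hρσ hρ'σ (C.sq_left hsq)) hsq⟩

end Germs

end SC

namespace SC

open PolytopeComplex

variable {C : PolytopeComplex.{v, u}} {A B D : SC C}

/-! ### Cofibrations and weak equivalences -/

theorem Span.definedOn_hom_iff (S : Span A B) {i : A.Idx} {y : C.Ob} :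
    DefinedOn S.hom i y ↔ ∃ s : {s // S.p s = i}, y ≤ S.apex.elt s.1 := by
  constructor
  · rintro ⟨j, y', τ, s, hp, -, hs⟩
    exact ⟨⟨s, hp⟩, C.sq_left hs⟩
  · rintro ⟨⟨s, rfl⟩, h⟩
    exact (IsGerm.definedOn (φ := S.hom) (S.isGerm_hor s)).of_le h

theorem Span.isCoveringSubmap_iff (S : Span A B) :
    IsCoveringSubmap S.apex.elt A.elt S.p ↔ ∀ i, TotalAt S.hom i := by
  constructor
  · exact fun h i => (isCoveringFamily_iff.1 (h.cover i)).2.mono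
      fun y _ => S.definedOn_hom_iff.2
  · refine fun h => ⟨S.sub, fun i => isCoveringFamily_iff.2 ⟨?_, ?_⟩⟩
    · rintro ⟨s, rfl⟩
      exact S.sub.le s
    · exact HoldsLocally.mono (h i) fun y _ => S.definedOn_hom_iff.1

theorem Span.injective_iff (S : Span A B) :
    Function.Injective S.f ↔ ∀ j, InjAt S.hom j := by
  constructor
  · rintro h j i i' y z x τ τ' - ⟨s, rfl, rfl, hs⟩ ⟨s', rfl, hf, hs'⟩
    obtain rfl := h hf
    exact ⟨rfl, C.sq_unique hs hs'⟩
  · intro h s s' hf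
    obtain ⟨hp, hsq⟩ := (h (S.f s)).sq_of_le (S.isGerm_hor s) (τ' := S.hor s')
      ⟨s', rfl, hf.symm, C.sq_vid _⟩ (by rw [hf]) (B.elt_ne_bot _)
    exact S.eq_of_le hp (S.apex.elt_ne_bot s) le_rfl (C.sq_left hsq)

theorem Span.inImage_hom_iff (S : Span A B) {j : B.Idx} :
    InImage S.hom j ↔ ∃ s, S.f s = j := by
  constructor
  · rintro ⟨i, y, y', τ, s, -, hf, -⟩
    exact ⟨s, hf⟩
  · rintro ⟨s, rfl⟩
    exact IsGerm.inImage (φ := S.hom) (S.isGerm_hor s)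

theorem cof_iff {φ : A ⟶ B} : cof C φ ↔ (∀ i, TotalAt φ i) ∧ ∀ j, InjAt φ j := by
  constructor
  · rintro ⟨S, rfl, hp, hf⟩
    exact ⟨S.isCoveringSubmap_iff.1 hp, S.injective_iff.1 hf⟩
  · rintro ⟨htotal, hinj⟩
    obtain ⟨S, rfl⟩ := exists_span φ
    exact ⟨S, rfl, S.isCoveringSubmap_iff.2 htotal, S.injective_iff.2 hinj⟩

theorem weq_iff {φ : A ⟶ B} : weq C φ ↔ cof C φ ∧ ∀ j, InImage φ j := by
  constructor
  · rintro ⟨S, rfl, hp, hf⟩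
    exact ⟨⟨S, rfl, hp, hf.1⟩, fun j => S.inImage_hom_iff.2 (hf.2 j)⟩
  · rintro ⟨⟨S, rfl, hp, hf⟩, him⟩
    exact ⟨S, rfl, hp, hf, fun j => S.inImage_hom_iff.1 (him j)⟩

section Properties

variable {φ : A ⟶ B} {ψ : B ⟶ D}

theorem totalAt_of_cof (h : cof C φ) (i : A.Idx) : TotalAt φ i := (cof_iff.1 h).1 i

theorem injAt_of_cof (h : cof C φ) (j : B.Idx) : InjAt φ j := (cof_iff.1 h).2 j

theorem cof_of_weq (h : weq C φ) : cof C φ := (weq_iff.1 h).1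

theorem inImage_of_weq (h : weq C φ) (j : B.Idx) : InImage φ j := (weq_iff.1 h).2 j

theorem cof_comp (hφ : cof C φ) (hψ : cof C ψ) : cof C (φ ≫ ψ) :=
  cof_iff.2 ⟨fun i => (totalAt_of_cof hφ i).comp fun j _ _ _ _ => totalAt_of_cof hψ j,
    fun k => InjAt.comp (injAt_of_cof hφ) (injAt_of_cof hψ k)⟩

theorem weq_comp (hφ : weq C φ) (hψ : weq C ψ) : weq C (φ ≫ ψ) := by
  refine weq_iff.2 ⟨cof_comp (cof_of_weq hφ) (cof_of_weq hψ), fun k => ?_⟩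
  obtain ⟨j, y, y', τ, hτ⟩ := inImage_of_weq hψ k
  exact (inImage_of_weq hφ j).comp hτ

theorem weq_of_precomp (hφ : weq C φ) (h : weq C (φ ≫ ψ)) : weq C ψ := by
  refine weq_iff.2 ⟨cof_iff.2 ⟨fun j => ?_, ?_⟩, fun k => (inImage_of_weq h k).of_comp⟩
  · exact (inImage_of_weq hφ j).totalAt fun i _ _ _ _ => totalAt_of_cof (cof_of_weq h) i
  · intro k j j' y z x τ τ' hx hτ hτ'
    exact (injAt_of_cof (cof_of_weq h) k).sq_of_inImage (inImage_of_weq hφ j)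
      (inImage_of_weq hφ j') hx hτ hτ'

theorem cof_of_postcomp (hψ : cof C ψ) (h : cof C (φ ≫ ψ)) : cof C φ :=
  cof_iff.2 ⟨fun i => (totalAt_of_cof h i).of_comp, fun j =>
    InjAt.of_comp (injAt_of_cof h) (totalAt_of_cof hψ j)⟩

theorem weq_of_postcomp (hψ : weq C ψ) (h : weq C (φ ≫ ψ)) : weq C φ := by
  refine weq_iff.2 ⟨cof_of_postcomp (cof_of_weq hψ) (cof_of_weq h), fun j => ?_⟩
  obtain ⟨w, -, hw, k, w', κ, hκ⟩ := exists_ne_bot_of_holdsLocally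
    (totalAt_of_cof (cof_of_weq hψ) j) (B.elt_ne_bot j)
  obtain ⟨i, z, ρ, hρ⟩ := (inImage_of_weq h k).exists_isGerm hκ.le_right
  obtain ⟨j', x, ρ₁, ρ₂, -, hρ₁, hρ₂⟩ := hρ.of_comp
  obtain ⟨rfl, -⟩ := injAt_of_cof (cof_of_weq hψ) k (right_ne_bot κ hw) hρ₂ hκ
  exact hρ₁.inImage

theorem weq_of_isIso (φ : A ⟶ B) [IsIso φ] : weq C φ := by
  have htotal (i : A.Idx) : TotalAt (φ ≫ inv φ) i := by
    rw [IsIso.hom_inv_id]; exact totalAt_id i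
  have htotal' (j : B.Idx) : TotalAt (inv φ ≫ φ) j := by
    rw [IsIso.inv_hom_id]; exact totalAt_id j
  have hinj (i : A.Idx) : InjAt (φ ≫ inv φ) i := by
    rw [IsIso.hom_inv_id]; exact injAt_id i
  have him (j : B.Idx) : InImage (inv φ ≫ φ) j := by
    rw [IsIso.inv_hom_id]; exact inImage_id j
  exact weq_iff.2 ⟨cof_iff.2 ⟨fun i => (htotal i).of_comp,
    fun j => InjAt.of_comp hinj (htotal' j).of_comp⟩, fun j => (him j).of_comp⟩

theorem definedOn_elt_of_isIso (φ : A ⟶ B) [IsIso φ] (i : A.Idx) : DefinedOn φ i (A.elt i) := by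
  apply DefinedOn.of_comp (ψ := inv φ)
  rw [IsIso.hom_inv_id]
  exact (isGerm_id_hid le_rfl).definedOn

end Properties

theorem cof_isMultiplicative (C : PolytopeComplex.{v, u}) : (cof C).IsMultiplicative where
  id_mem A := cof_of_weq (weq_of_isIso (𝟙 A))
  comp_mem _ _ := cof_comp

theorem weq_isMultiplicative (C : PolytopeComplex.{v, u}) : (weq C).IsMultiplicative where
  id_mem A := weq_of_isIso (𝟙 A)
  comp_mem _ _ := weq_comp

theorem weq_hasTwoOutOfThreeProperty (C : PolytopeComplex.{v, u}) :
    (weq C).HasTwoOutOfThreeProperty where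
  comp_mem _ _ := weq_comp
  of_postcomp _ _ := weq_of_postcomp
  of_precomp _ _ := weq_of_precomp

/-! ### The zero object -/

theorem hom_subsingleton_of_isEmpty (h : IsEmpty A.Idx ∨ IsEmpty B.Idx) (φ ψ : A ⟶ B) :
    φ = ψ := by
  refine hom_ext fun i j _ _ _ _ => ?_
  rcases h with h | h
  · exact h.elim i
  · exact h.elim j

theorem isZero_of_isEmpty (Z : SC C) [IsEmpty Z.Idx] : IsZero Z where
  unique_to _ := ⟨⟨⟨Span.hom
    { apex := Z, p := id, sub := ⟨isEmptyElim, isEmptyElim⟩, f := isEmptyElim,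
      hor := isEmptyElim }⟩, fun _ => hom_subsingleton_of_isEmpty (.inl inferInstance) _ _⟩⟩
  unique_from _ := ⟨⟨⟨Span.hom
    { apex := Z, p := isEmptyElim, sub := ⟨isEmptyElim, isEmptyElim⟩, f := id,
      hor := isEmptyElim }⟩, fun _ => hom_subsingleton_of_isEmpty (.inr inferInstance) _ _⟩⟩

/-- The empty family, the zero object of `SC(C)`. -/
def empty (C : PolytopeComplex.{v, u}) : SC C where
  val _ := C.bot
  finite := by simp

instance : IsEmpty (empty C).Idx := ⟨fun i => i.2 rfl⟩

theorem isZero_iff_isEmpty {Z : SC C} : IsZero Z ↔ IsEmpty Z.Idx := by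
  refine ⟨fun h => ⟨fun i => ?_⟩, fun _ => isZero_of_isEmpty Z⟩
  have h0 := isZero_of_isEmpty (empty C)
  have hi : IsGerm (h0.from_ Z ≫ h0.to_ Z) i i (C.hid (Z.elt i)) :=
    h.eq_of_src (𝟙 Z) (h0.from_ Z ≫ h0.to_ Z) ▸ isGerm_id_hid le_rfl
  obtain ⟨j, -⟩ := hi.of_comp
  exact isEmptyElim j

theorem cof_of_isZero (h : IsZero A) (φ : A ⟶ B) : cof C φ := by
  have := isZero_iff_isEmpty.1 h
  exact cof_iff.2 ⟨fun i => isEmptyElim i, fun _ i => isEmptyElim i⟩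

end SC

namespace SC

open PolytopeComplex

variable {C : PolytopeComplex.{v, u}}

/-! ### Construction of morphisms -/

section Construction

variable {A B : SC C} {i : A.Idx} {j : B.Idx} {y y' : C.Ob} {τ : C.Hor y y'}

/-- A shuffle, as a morphism of `SC(C)`. -/
def shuffle (f : A.Idx → B.Idx) (hor : ∀ i, C.Hor (A.elt i) (B.elt (f i))) : A ⟶ B :=
  Span.hom
    { apex := A, p := id, sub := ⟨fun _ => le_rfl, fun _ _ h h' => absurd h' h⟩, f := f,
      hor := hor }

theorem isGerm_shuffle_iff {f : A.Idx → B.Idx} {hor : ∀ i, C.Hor (A.elt i) (B.elt (f i))} :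
    IsGerm (shuffle f hor) i j τ ↔ f i = j ∧ C.Sq τ (hor i) := by
  constructor
  · rintro ⟨i, rfl, rfl, h⟩
    exact ⟨rfl, h⟩
  · rintro ⟨rfl, h⟩
    exact ⟨i, rfl, rfl, h⟩

theorem weq_shuffle {f : A.Idx → B.Idx} (hf : Function.Bijective f)
    (hor : ∀ i, C.Hor (A.elt i) (B.elt (f i))) : weq C (shuffle f hor) :=
  ⟨_, rfl, (Span.isCoveringSubmap_iff _).2 fun _ => HoldsLocally.of_forall fun _ =>
    (isGerm_shuffle_iff.2 ⟨rfl, C.sq_vid _⟩).definedOn.of_le, hf⟩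

/-- The identity, as a horizontal morphism between equal objects. -/
def horOfEq {a b : C.Ob} (h : a = b) : C.Hor a b := h ▸ C.hid a

theorem sq_horOfEq_iff {a b : C.Ob} (h : a = b) : C.Sq τ (horOfEq h) ↔ C.Sq τ (C.hid a) := by
  subst h
  rfl

/-- The shuffle whose components are identities, exhibiting the members of `A` as members of `B`. -/
def inclusion (f : A.Idx → B.Idx) (h : ∀ i, A.elt i = B.elt (f i)) : A ⟶ B :=
  shuffle f fun i => horOfEq (h i)

theorem isGerm_inclusion_iff {f : A.Idx → B.Idx} {h : ∀ i, A.elt i = B.elt (f i)} :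
    IsGerm (inclusion f h) i j τ ↔ f i = j ∧ C.Sq τ (C.hid (A.elt i)) :=
  isGerm_shuffle_iff.trans (and_congr_right fun _ => sq_horOfEq_iff (h i))

theorem definedOn_inclusion {f : A.Idx → B.Idx} {h : ∀ i, A.elt i = B.elt (f i)} (i : A.Idx) :
    DefinedOn (inclusion f h) i (A.elt i) :=
  (isGerm_inclusion_iff.2 ⟨rfl, C.sq_vid _⟩).definedOn

theorem inImage_inclusion_iff {f : A.Idx → B.Idx} {h : ∀ i, A.elt i = B.elt (f i)} :
    InImage (inclusion f h) j ↔ ∃ i, f i = j := by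
  constructor
  · rintro ⟨i, y, y', τ, hτ⟩
    exact ⟨i, (isGerm_inclusion_iff.1 hτ).1⟩
  · rintro ⟨i, hi⟩
    exact (isGerm_inclusion_iff.2 ⟨hi, C.sq_vid _⟩).inImage

theorem injAt_inclusion {f : A.Idx → B.Idx} {h : ∀ i, A.elt i = B.elt (f i)}
    (hf : Function.Injective f) (j : B.Idx) : InjAt (inclusion f h) j := by
  rintro i i' y z x τ τ' - hτ hτ'
  obtain ⟨rfl, hsq⟩ := isGerm_inclusion_iff.1 hτ
  obtain ⟨hi, hsq'⟩ := isGerm_inclusion_iff.1 hτ'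
  obtain rfl := hf hi
  exact ⟨rfl, C.sq_unique hsq hsq'⟩

theorem cof_inclusion {f : A.Idx → B.Idx} {h : ∀ i, A.elt i = B.elt (f i)}
    (hf : Function.Injective f) : cof C (inclusion f h) :=
  cof_iff.2 ⟨fun i => HoldsLocally.of_forall fun _ => (definedOn_inclusion i).of_le,
    injAt_inclusion hf⟩

/-- A sub-map `p : B ⇢ A`, as a morphism `A ⟶ B` of `SC(C)`. -/
def ofSubmap {p : B.Idx → A.Idx} (hp : IsSubmap B.elt A.elt p) : A ⟶ B :=
  Span.hom { apex := B, p := p, sub := hp, f := id, hor := fun _ => C.hid _ }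

theorem isGerm_ofSubmap_iff {p : B.Idx → A.Idx} {hp : IsSubmap B.elt A.elt p} :
    IsGerm (ofSubmap hp) i j τ ↔ p j = i ∧ C.Sq τ (C.hid (B.elt j)) := by
  constructor
  · rintro ⟨j, rfl, rfl, h⟩
    exact ⟨rfl, h⟩
  · rintro ⟨rfl, h⟩
    exact ⟨j, rfl, rfl, h⟩

theorem definedOn_ofSubmap_iff {p : B.Idx → A.Idx} {hp : IsSubmap B.elt A.elt p} :
    DefinedOn (ofSubmap hp) i y ↔ ∃ j, p j = i ∧ y ≤ B.elt j := by
  refine (Span.definedOn_hom_iff _).trans ⟨?_, ?_⟩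
  · rintro ⟨⟨j, hj⟩, hy⟩
    exact ⟨j, hj, hy⟩
  · rintro ⟨j, hj, hy⟩
    exact ⟨⟨j, hj⟩, hy⟩

theorem weq_ofSubmap {p : B.Idx → A.Idx} {hp : IsSubmap B.elt A.elt p}
    (h : ∀ i, TotalAt (ofSubmap hp) i) : weq C (ofSubmap hp) :=
  ⟨_, rfl, (Span.isCoveringSubmap_iff _).2 h, Function.bijective_id⟩

theorem isSubmap_of_eq {I : Type*} {x : I → C.Ob} {p : I → A.Idx} (hle : ∀ s, x s ≤ A.elt (p s))
    (h : ∀ s s' w, w ≠ C.bot → p s = p s' → w ≤ x s → w ≤ x s' → s = s') :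
    IsSubmap x A.elt p := by
  refine ⟨hle, fun s s' hs hp => isGLB_bot_iff.2 fun w hw hw' => ?_⟩
  by_contra hne
  exact hs (h s s' w hne hp hw hw')

variable {I : Type} [Finite I]

theorem exists_family (x : I → C.Ob) (hx : ∀ s, x s ≠ C.bot) :
    ∃ (P : SC C) (e : P.Idx ≃ I), ∀ k, P.elt k = x (e k) :=
  ⟨_, _, ofFamily_elt x hx ((Finite.equivFin I).toEmbedding.trans Fin.valEmbedding)⟩

theorem exists_hom_of_components {x : I → C.Ob} (hx : ∀ s, x s ≠ C.bot) {p : I → A.Idx}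
    (hp : IsSubmap x A.elt p) {f : I → B.Idx} (hor : ∀ s, C.Hor (x s) (B.elt (f s))) :
    ∃ φ : A ⟶ B, ∀ (i : A.Idx) (j : B.Idx) (y y' : C.Ob) (τ : C.Hor y y'),
      IsGerm φ i j τ ↔ ∃ s, p s = i ∧ f s = j ∧ C.Sq τ (hor s) := by
  obtain ⟨P, e, he⟩ := exists_family x hx
  have exists_hor (k) : ∃ σ : C.Hor (P.elt k) (B.elt (f (e k))),
      C.Sq σ (hor (e k)) ∧ C.Sq (hor (e k)) σ := by
    rw [he k]
    exact ⟨hor (e k), C.sq_vid _, C.sq_vid _⟩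
  choose σ hσ hσ' using exists_hor
  refine ⟨Span.hom
    { apex := P, p := fun k => p (e k), f := fun k => f (e k), hor := σ,
      sub := ⟨fun k => by rw [he]; exact hp.le _, fun k k' hk h => ?_⟩ }, fun i j y y' τ => ?_⟩
  · rw [he, he]
    exact hp.disjoint _ _ (fun h' => hk (e.injective h')) h
  · constructor
    · rintro ⟨k, h₁, h₂, h₃⟩
      exact ⟨e k, h₁, h₂, C.sq_vcomp h₃ (hσ k)⟩
    · rintro ⟨s, h₁, h₂, h₃⟩
      obtain ⟨k, rfl⟩ := e.surjective s
      exact ⟨k, h₁, h₂, C.sq_vcomp h₃ (hσ' k)⟩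

theorem exists_piecewise (p : A.Idx → Prop) (t t' : A ⟶ B) :
    ∃ r : A ⟶ B,
      (∀ i, p i → ∀ (j : B.Idx) (y y' : C.Ob) (τ : C.Hor y y'),
        IsGerm r i j τ ↔ IsGerm t i j τ) ∧
      ∀ i, ¬ p i → ∀ (j : B.Idx) (y y' : C.Ob) (τ : C.Hor y y'),
        IsGerm r i j τ ↔ IsGerm t' i j τ := by
  obtain ⟨T, rfl⟩ := exists_span t
  obtain ⟨T', rfl⟩ := exists_span t'
  obtain ⟨r, hr⟩ := exists_hom_of_components (A := A) (B := B)
    (I := {s // p (T.p s)} ⊕ {s // ¬ p (T'.p s)})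
    (x := Sum.elim (fun s => T.apex.elt s.1) fun s => T'.apex.elt s.1)
    (p := Sum.elim (fun s => T.p s.1) fun s => T'.p s.1)
    (f := Sum.elim (fun s => T.f s.1) fun s => T'.f s.1)
    (by rintro (s | s) <;> exact elt_ne_bot _ _)
    (isSubmap_of_eq (by rintro (s | s) <;> exact Span.sub _ |>.le _) (by
      rintro (s | s) (s' | s') w hw hp hs hs'
      · rw [Subtype.ext (T.eq_of_le hp hw hs hs')]
      · exact absurd ((congrArg p hp).mp s.2) s'.2
      · exact absurd ((congrArg p hp).mpr s'.2) s.2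
      · rw [Subtype.ext (T'.eq_of_le hp hw hs hs')]))
    (Sum.rec (fun s => T.hor s.1) fun s => T'.hor s.1)
  refine ⟨r, fun i hi j y y' τ => (hr i j y y' τ).trans ⟨?_, ?_⟩,
    fun i hi j y y' τ => (hr i j y y' τ).trans ⟨?_, ?_⟩⟩
  · rintro ⟨s | s, rfl, rfl, h⟩
    · exact ⟨s, rfl, rfl, h⟩
    · exact absurd hi s.2
  · rintro ⟨s, rfl, rfl, h⟩
    exact ⟨Sum.inl ⟨s, hi⟩, rfl, rfl, h⟩
  · rintro ⟨s | s, rfl, rfl, h⟩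
    · exact absurd s.2 hi
    · exact ⟨s, rfl, rfl, h⟩
  · rintro ⟨s, rfl, rfl, h⟩
    exact ⟨Sum.inr ⟨s, hi⟩, rfl, rfl, h⟩

theorem comp_eq_comp_of_inImage {D : SC C} {φ : A ⟶ B} {ψ ψ' : B ⟶ D}
    (h : ∀ j, InImage φ j → ∀ (k : D.Idx) (y y' : C.Ob) (τ : C.Hor y y'),
      IsGerm ψ j k τ ↔ IsGerm ψ' j k τ) : φ ≫ ψ = φ ≫ ψ' := by
  refine hom_ext fun i k y y' τ _ => ⟨fun hτ => ?_, fun hτ => ?_⟩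
  all_goals obtain ⟨j, x, τ₁, τ₂, rfl, h₁, h₂⟩ := hτ.of_comp
  · exact h₁.comp ((h j h₁.inImage k _ _ τ₂).1 h₂)
  · exact h₁.comp ((h j h₁.inImage k _ _ τ₂).2 h₂)

end Construction

section Factorization

variable {A B D : SC C} {φ : A ⟶ B}

theorem hom_ext_of_inImage {ψ ψ' : B ⟶ D} (hφ : ∀ j, InImage φ j) (h : φ ≫ ψ = φ ≫ ψ') :
    ψ = ψ' :=
  hom_ext fun j _ _ _ _ hy =>
    ⟨(hφ j).isGerm_of_comp_eq h hy, (hφ j).isGerm_of_comp_eq h.symm hy⟩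

theorem inImage_comp_iff {ψ : B ⟶ D} {k : D.Idx} (hφ : ∀ j, InImage φ j) :
    InImage (φ ≫ ψ) k ↔ InImage ψ k :=
  ⟨InImage.of_comp, fun ⟨j, _, _, _, hτ⟩ => (hφ j).comp hτ⟩

theorem InjAt.inImage_comp_iff {ψ : B ⟶ D} {j : B.Idx} {k : D.Idx} {y y' : C.Ob}
    {τ : C.Hor y y'} (h : InjAt ψ k) (hτ : IsGerm ψ j k τ) : InImage (φ ≫ ψ) k ↔ InImage φ j := by
  refine ⟨fun ⟨i, x, x', ρ, hρ⟩ => ?_, fun h => h.comp hτ⟩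
  obtain ⟨j', z, ρ₁, ρ₂, -, h₁, h₂⟩ := hρ.of_comp
  obtain ⟨a, σ, hσ, -⟩ := hτ.exists_component
  obtain ⟨a', σ', hσ', -⟩ := h₂.exists_component
  obtain ⟨rfl, -⟩ := h (D.elt_ne_bot k) hσ hσ'
  exact h₁.inImage

theorem exists_comp_eq {χ : A ⟶ D} (hφ : ∀ j, InjAt φ j)
    (h : ∀ i y, y ≠ C.bot → DefinedOn χ i y → DefinedOn φ i y) : ∃ ψ : B ⟶ D, φ ≫ ψ = χ := by
  obtain ⟨X, rfl⟩ := exists_span χ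
  choose j y' κ hκ using fun s : X.apex.Idx => h _ _ (X.apex.elt_ne_bot s)
    (IsGerm.definedOn (φ := X.hom) (X.isGerm_hor s))
  have hX (s : X.apex.Idx) : IsGerm X.hom (X.p s) (X.f s) (X.hor s) := X.isGerm_hor s
  obtain ⟨ψ, hψ⟩ := exists_hom_of_components (A := B) (B := D) (x := y') (p := j) (f := X.f)
    (fun s => right_ne_bot (κ s) (X.apex.elt_ne_bot s))
    (isSubmap_of_eq (fun s => (hκ s).le_right) (by
      intro s s' w hw hjs hs hs'
      obtain ⟨x, ρ, hρ⟩ := C.exists_sq (κ s) hs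
      have hκs' := hκ s'
      rw [← hjs] at hκs'
      obtain ⟨hp, hsq⟩ := (hφ _).sq_of_le ((hκ s).restrict hρ) hκs' hs' hw
      exact X.eq_of_le hp (left_ne_bot ρ hw) (C.sq_left hρ) (C.sq_left hsq)))
    (fun s => C.hcomp (C.hinv (κ s)) (X.hor s))
  refine ⟨ψ, hom_ext fun i k y z τ hy => ⟨fun hτ => ?_, ?_⟩⟩
  · obtain ⟨j', x, τ₁, τ₂, rfl, h₁, h₂⟩ := hτ.of_comp
    obtain ⟨s, rfl, rfl, hs⟩ := (hψ _ _ _ _ _).1 h₂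
    obtain ⟨w, ρ, hρ⟩ := C.exists_sq (κ s) (C.sq_left hs)
    obtain ⟨rfl, hsq⟩ := hφ _ (right_ne_bot τ₁ hy) h₁ ((hκ s).restrict hρ)
    have hsq' := C.sq_hcomp (C.sq_vcomp hsq hρ) hs
    rw [hcomp_hinv_cancel] at hsq'
    exact (hX s).restrict hsq'
  · rintro ⟨s, rfl, rfl, hs⟩
    suffices IsGerm (φ ≫ ψ) (X.p s) (X.f s) (X.hor s) from this.restrict hs
    rw [← hcomp_hinv_cancel (κ s) (X.hor s)]
    exact (hκ s).comp ((hψ _ _ _ _ _).2 ⟨s, rfl, rfl, C.sq_vid _⟩)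

end Factorization

/-! ### Coproducts -/

section Coproduct

variable {A B P : SC C}

/-- `P` is the disjoint union of the families `A` and `B`: `l` and `r` are injective shuffles and
each member of `P` is in the image of exactly one of them. -/
structure IsDisjointUnion (l : A ⟶ P) (r : B ⟶ P) : Prop where
  definedOn_left : ∀ i, DefinedOn l i (A.elt i)
  definedOn_right : ∀ i, DefinedOn r i (B.elt i)
  injAt_left : ∀ k, InjAt l k
  injAt_right : ∀ k, InjAt r k
  inImage_right_iff : ∀ k, InImage r k ↔ ¬ InImage l k

namespace IsDisjointUnion

variable {l : A ⟶ P} {r : B ⟶ P}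

theorem exists_desc (h : IsDisjointUnion l r) {Y : SC C} (u : A ⟶ Y) (v : B ⟶ Y) :
    ∃ t : P ⟶ Y, l ≫ t = u ∧ r ≫ t = v := by
  obtain ⟨t, rfl⟩ := exists_comp_eq h.injAt_left (χ := u) fun i _ _ ⟨_, _, _, hu⟩ =>
    (h.definedOn_left i).of_le hu.le_left
  obtain ⟨t', rfl⟩ := exists_comp_eq h.injAt_right (χ := v) fun i _ _ ⟨_, _, _, hv⟩ =>
    (h.definedOn_right i).of_le hv.le_left
  obtain ⟨s, hs, hs'⟩ := exists_piecewise (InImage l) t t'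
  exact ⟨s, comp_eq_comp_of_inImage hs,
    comp_eq_comp_of_inImage fun k hk => hs' k ((h.inImage_right_iff k).1 hk)⟩

theorem hom_ext (h : IsDisjointUnion l r) {Y : SC C} {t t' : P ⟶ Y} (hl : l ≫ t = l ≫ t')
    (hr : r ≫ t = r ≫ t') : t = t' := by
  refine SC.hom_ext fun k _ _ _ _ hy => ?_
  by_cases hk : InImage l k
  · exact ⟨hk.isGerm_of_comp_eq hl hy, hk.isGerm_of_comp_eq hl.symm hy⟩
  · rw [← h.inImage_right_iff] at hk
    exact ⟨hk.isGerm_of_comp_eq hr hy, hk.isGerm_of_comp_eq hr.symm hy⟩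

theorem nonempty_isColimit (h : IsDisjointUnion l r) :
    Nonempty (IsColimit (BinaryCofan.mk l r)) := by
  choose t ht ht' using fun s : BinaryCofan A B => h.exists_desc s.inl s.inr
  exact ⟨BinaryCofan.isColimitMk t ht ht' fun s m hm hm' =>
    h.hom_ext (hm.trans (ht s).symm) (hm'.trans (ht' s).symm)⟩

theorem symm (h : IsDisjointUnion l r) : IsDisjointUnion r l where
  definedOn_left := h.definedOn_right
  definedOn_right := h.definedOn_left
  injAt_left := h.injAt_right
  injAt_right := h.injAt_left
  inImage_right_iff k := by rw [h.inImage_right_iff, not_not]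

theorem cof_left (h : IsDisjointUnion l r) : cof C l :=
  cof_iff.2 ⟨fun i => HoldsLocally.of_forall fun _ => (h.definedOn_left i).of_le, h.injAt_left⟩

theorem isPushout (h : IsDisjointUnion l r) {X P' : SC C} {l' : X ⟶ P'} {r' : B ⟶ P'}
    (h' : IsDisjointUnion l' r') {f : A ⟶ X} {t : P ⟶ P'} (hl : l ≫ t = f ≫ l')
    (hr : r ≫ t = r') : IsPushout l f t l' := by
  choose d hd hd' using fun s : PushoutCocone l f => h'.exists_desc s.inr (r ≫ s.inl)
  refine ⟨⟨hl⟩, ⟨PushoutCocone.IsColimit.mk hl d (fun s => h.hom_ext ?_ ?_) hd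
    fun s m hm hm' => h'.hom_ext ?_ ?_⟩⟩
  · rw [reassoc_of% hl, hd, s.condition]
  · rw [reassoc_of% hr, hd']
  · rw [hm', hd]
  · rw [hd', ← hr, Category.assoc, hm]

theorem weq_desc (h : IsDisjointUnion l r) {D : SC C} {t : P ⟶ D} (hl : cof C (l ≫ t))
    (hr : cof C (r ≫ t)) (him : ∀ d, InImage (r ≫ t) d ↔ ¬ InImage (l ≫ t) d) : weq C t := by
  refine weq_iff.2 ⟨cof_iff.2 ⟨fun k => ?_, fun d k k' y z x τ τ' hx hτ hτ' => ?_⟩, fun d => ?_⟩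
  · by_cases hk : InImage l k
    · exact hk.totalAt fun i _ _ _ _ => totalAt_of_cof hl i
    · exact ((h.inImage_right_iff k).2 hk).totalAt fun i _ _ _ _ => totalAt_of_cof hr i
  · by_cases hk : InImage l k <;> by_cases hk' : InImage l k'
    · exact (injAt_of_cof hl d).sq_of_inImage hk hk' hx hτ hτ'
    · exact absurd (hk.comp hτ) ((him d).1 (((h.inImage_right_iff k').2 hk').comp hτ'))
    · exact absurd (hk'.comp hτ') ((him d).1 (((h.inImage_right_iff k).2 hk).comp hτ))
    · rw [← h.inImage_right_iff] at hk hk'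
      exact (injAt_of_cof hr d).sq_of_inImage hk hk' hx hτ hτ'
  · by_cases hd : InImage (l ≫ t) d
    · exact hd.of_comp
    · exact ((him d).2 hd).of_comp

theorem weq_of_comm (h : IsDisjointUnion l r) {A' B' P' : SC C} {l' : A' ⟶ P'} {r' : B' ⟶ P'}
    (h' : IsDisjointUnion l' r') {a : A ⟶ A'} {b : B ⟶ B'} {t : P ⟶ P'} (hl : l ≫ t = a ≫ l')
    (hr : r ≫ t = b ≫ r') (ha : weq C a) (hb : weq C b) : weq C t := by
  refine h.weq_desc ?_ ?_ fun k => ?_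
  · exact hl ▸ cof_comp (cof_of_weq ha) h'.cof_left
  · exact hr ▸ cof_comp (cof_of_weq hb) h'.symm.cof_left
  · rw [hl, hr, inImage_comp_iff (inImage_of_weq ha), inImage_comp_iff (inImage_of_weq hb),
      h'.inImage_right_iff]

theorem comp_isIso (h : IsDisjointUnion l r) {P' : SC C} (θ : P ⟶ P') [IsIso θ] :
    IsDisjointUnion (l ≫ θ) (r ≫ θ) := by
  have hθ := weq_iff.1 (weq_of_isIso θ)
  have definedOn {A : SC C} {i : A.Idx} {l : A ⟶ P} (hl : DefinedOn l i (A.elt i)) :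
      DefinedOn (l ≫ θ) i (A.elt i) := by
    obtain ⟨k, y, τ, hτ⟩ := hl
    obtain ⟨k', y', τ', hτ'⟩ := (definedOn_elt_of_isIso θ k).of_le hτ.le_right
    exact (hτ.comp hτ').definedOn
  refine ⟨fun i => definedOn (h.definedOn_left i), fun i => definedOn (h.definedOn_right i),
    fun k => InjAt.comp h.injAt_left (injAt_of_cof hθ.1 k),
    fun k => InjAt.comp h.injAt_right (injAt_of_cof hθ.1 k), fun k => ?_⟩
  obtain ⟨k₀, y, y', τ, hτ⟩ := hθ.2 k
  rw [(injAt_of_cof hθ.1 k).inImage_comp_iff hτ, (injAt_of_cof hθ.1 k).inImage_comp_iff hτ,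
    h.inImage_right_iff]

end IsDisjointUnion

theorem exists_isDisjointUnion (A B : SC C) :
    ∃ (P : SC C) (l : A ⟶ P) (r : B ⟶ P), IsDisjointUnion l r := by
  obtain ⟨P, e, he⟩ := exists_family (Sum.elim A.elt B.elt)
    (by rintro (i | i) <;> exact elt_ne_bot _ _)
  refine ⟨P, inclusion (fun i => e.symm (Sum.inl i)) (by simp [he]),
    inclusion (fun i => e.symm (Sum.inr i)) (by simp [he]), definedOn_inclusion,
    definedOn_inclusion, injAt_inclusion (e.symm.injective.comp Sum.inl_injective),
    injAt_inclusion (e.symm.injective.comp Sum.inr_injective), fun k => ?_⟩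
  rw [inImage_inclusion_iff, inImage_inclusion_iff]
  obtain ⟨i | i, rfl⟩ := e.symm.surjective k <;> simp

theorem isDisjointUnion_of_isColimit {c : BinaryCofan A B} (hc : IsColimit c) :
    IsDisjointUnion c.inl c.inr := by
  obtain ⟨P, l, r, h⟩ := exists_isDisjointUnion A B
  obtain ⟨hP⟩ := h.nonempty_isColimit
  let θ : P ≅ c.pt := hP.coconePointUniqueUpToIso hc
  have hl : l ≫ θ.hom = c.inl := hP.comp_coconePointUniqueUpToIso_hom hc ⟨WalkingPair.left⟩
  have hr : r ≫ θ.hom = c.inr := hP.comp_coconePointUniqueUpToIso_hom hc ⟨WalkingPair.right⟩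
  rw [← hl, ← hr]
  exact h.comp_isIso θ.hom

end Coproduct

end SC

namespace SC

open PolytopeComplex

variable {C D : PolytopeComplex.{v, u}} (F : C ⟶ D)

/-! ### The action of polytope functors on morphisms -/

section Map

variable {A B : SC C} {φ : A ⟶ B}

theorem exists_idxIncl_eq {i : A.Idx} (h : F.obj (A.elt i) ≠ D.bot) :
    ∃ i' : (mapObj F A).Idx, idxIncl F A i' = i := ⟨⟨i.1, h⟩, rfl⟩

theorem isGerm_map_iff {i : (mapObj F A).Idx} {j : (mapObj F B).Idx} {y y' : D.Ob}
    {τ : D.Hor y y'} (hy : y ≠ D.bot) :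
    IsGerm ((map F).map φ) i j τ ↔ ∃ (z z' : C.Ob) (ρ : C.Hor z z'),
      IsGerm φ (idxIncl F A i) (idxIncl F B j) ρ ∧ D.Sq τ (F.hmap ρ) := by
  obtain ⟨S, rfl⟩ := exists_span φ
  constructor
  · rintro ⟨s, rfl, rfl, hs⟩
    exact ⟨_, _, _, S.isGerm_hor (idxIncl F _ s), hs⟩
  · rintro ⟨z, z', ρ, ⟨s, hp, hf, hs⟩, hτ⟩
    have hτ' := D.sq_vcomp hτ (F.sq hs)
    obtain ⟨s', rfl⟩ := exists_idxIncl_eq F (ne_bot_of_le (D.sq_left hτ') hy)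
    exact ⟨s', idxIncl_injective F A hp, idxIncl_injective F B hf, hτ'⟩

theorem definedOn_map_iff {i : (mapObj F A).Idx} {y : D.Ob} (hy : y ≠ D.bot) :
    DefinedOn ((map F).map φ) i y ↔ ∃ z, DefinedOn φ (idxIncl F A i) z ∧ y ≤ F.obj z := by
  constructor
  · rintro ⟨j, y', τ, hτ⟩
    obtain ⟨z, z', ρ, hρ, hsq⟩ := (isGerm_map_iff F hy).1 hτ
    exact ⟨z, hρ.definedOn, D.sq_left hsq⟩
  · rintro ⟨z, ⟨j, z', τ, hτ⟩, hyz⟩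
    have hz := ne_bot_of_le hyz hy
    obtain ⟨j', rfl⟩ := exists_idxIncl_eq F
      (ne_bot_of_le (F.mono hτ.le_right) (right_ne_bot (F.hmap τ) hz))
    exact DefinedOn.of_le ((isGerm_map_iff F hz).2 ⟨_, _, τ, hτ, D.sq_vid _⟩).definedOn hyz

theorem inImage_map_iff {j : (mapObj F B).Idx} :
    InImage ((map F).map φ) j ↔ InImage φ (idxIncl F B j) := by
  constructor
  · intro h
    obtain ⟨i, y, τ, hτ⟩ := h.exists_isGerm le_rfl
    obtain ⟨z, z', ρ, hρ, -⟩ := (isGerm_map_iff F (left_ne_bot τ (elt_ne_bot _ j))).1 hτ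
    exact hρ.inImage
  · intro h
    obtain ⟨i, y, τ, hτ⟩ := h.exists_isGerm le_rfl
    have hy : F.obj y ≠ D.bot := left_ne_bot (F.hmap τ) (elt_ne_bot _ j)
    obtain ⟨i', rfl⟩ := exists_idxIncl_eq F (ne_bot_of_le (F.mono hτ.le_left) hy)
    exact IsGerm.inImage ((isGerm_map_iff F hy).2 ⟨_, _, τ, hτ, D.sq_vid _⟩)

theorem totalAt_map {i : (mapObj F A).Idx} (h : TotalAt φ (idxIncl F A i)) :
    TotalAt ((map F).map φ) i := by
  obtain ⟨S, rfl⟩ := exists_span φ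
  have hcover := isCoveringFamily_iff.2 ⟨fun s => ?_, h.mono fun _ _ => S.definedOn_hom_iff.1⟩
  · refine holdsLocally_of_ne_bot i.2 (fun b c hbc hc => hc.of_le hbc)
      ((isCoveringFamily_iff.1 (F.isCoveringFamily hcover)).2.mono ?_)
    rintro y - ⟨s, hs⟩ hy
    exact (definedOn_map_iff F hy).2 ⟨_, S.definedOn_hom_iff.2 ⟨s, le_rfl⟩, hs⟩
  · exact (S.sub.le s.1).trans_eq (by rw [s.2])

theorem injAt_map {j : (mapObj F B).Idx} (h : InjAt φ (idxIncl F B j)) :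
    InjAt ((map F).map φ) j := by
  rintro i i' y z x τ τ' hx hτ hτ'
  obtain ⟨_, _, ρ, hρ, hsq⟩ := (isGerm_map_iff F (left_ne_bot τ hx)).1 hτ
  obtain ⟨_, _, ρ', hρ', hsq'⟩ := (isGerm_map_iff F (left_ne_bot τ' hx)).1 hτ'
  obtain ⟨_, σ, hσ, hρσ⟩ := hρ.exists_component
  obtain ⟨_, σ', hσ', hρσ'⟩ := hρ'.exists_component
  obtain ⟨hi, hσσ'⟩ := h (elt_ne_bot _ _) hσ hσ'
  exact ⟨idxIncl_injective F A hi,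
    D.sq_unique (D.sq_vcomp hsq (F.sq (C.sq_vcomp hρσ hσσ'))) (D.sq_vcomp hsq' (F.sq hρσ'))⟩

theorem cof_map (h : cof C φ) : cof D ((map F).map φ) :=
  cof_iff.2 ⟨fun _ => totalAt_map F (totalAt_of_cof h _), fun _ => injAt_map F (injAt_of_cof h _)⟩

theorem weq_map (h : weq C φ) : weq D ((map F).map φ) :=
  weq_iff.2 ⟨cof_map F (cof_of_weq h), fun _ => (inImage_map_iff F).2 (inImage_of_weq h _)⟩

theorem IsDisjointUnion.map {P : SC C} {l : A ⟶ P} {r : B ⟶ P} (h : IsDisjointUnion l r) :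
    IsDisjointUnion ((SC.map F).map l) ((SC.map F).map r) where
  definedOn_left i := (definedOn_map_iff F i.2).2 ⟨_, h.definedOn_left _, le_rfl⟩
  definedOn_right i := (definedOn_map_iff F i.2).2 ⟨_, h.definedOn_right _, le_rfl⟩
  injAt_left _ := injAt_map F (h.injAt_left _)
  injAt_right _ := injAt_map F (h.injAt_right _)
  inImage_right_iff _ := (inImage_map_iff F).trans
    ((h.inImage_right_iff _).trans (not_congr (inImage_map_iff F)).symm)

end Map

end SC

namespace SC

open PolytopeComplex

variable {C : PolytopeComplex.{v, u}}

/-! ### Subfamilies -/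

section Part

variable {A B D : SC C} {p : B.Idx → Prop}

/-- The subfamily of `B` consisting of the members whose indices satisfy `p`. -/
noncomputable def part (B : SC C) (p : B.Idx → Prop) : SC C :=
  ofFamily (fun b : {b // p b} => B.elt b.1)
    ((Function.Embedding.subtype p).trans (Function.Embedding.subtype _))

/-- The indices of a subfamily, as indices of the whole family. -/
noncomputable def partEquiv (B : SC C) (p : B.Idx → Prop) : (B.part p).Idx ≃ {b // p b} :=
  ofFamilyEquiv (fun b : {b // p b} => B.elt b.1) (fun b => B.elt_ne_bot b.1) _

theorem part_elt (k : (B.part p).Idx) : (B.part p).elt k = B.elt (B.partEquiv p k).1 :=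
  ofFamily_elt (fun b : {b // p b} => B.elt b.1) (fun b => B.elt_ne_bot b.1) _ k

/-- The inclusion of a subfamily. -/
noncomputable def partIncl (B : SC C) (p : B.Idx → Prop) : B.part p ⟶ B :=
  inclusion (fun k => (B.partEquiv p k).1) part_elt

/-- The projection onto a subfamily, which forgets the other members. -/
noncomputable def partProj (B : SC C) (p : B.Idx → Prop) : B ⟶ B.part p :=
  ofSubmap (p := fun k => (B.partEquiv p k).1) ⟨fun k => (part_elt k).le, fun _ _ hk h =>
    absurd ((B.partEquiv p).injective (Subtype.ext h)) hk⟩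

theorem inImage_partIncl_iff {b : B.Idx} : InImage (B.partIncl p) b ↔ p b := by
  rw [partIncl, inImage_inclusion_iff]
  constructor
  · rintro ⟨k, rfl⟩
    exact (B.partEquiv p k).2
  · exact fun h => ⟨(B.partEquiv p).symm ⟨b, h⟩, by simp⟩

theorem cof_partIncl : cof C (B.partIncl p) :=
  cof_inclusion (Subtype.val_injective.comp (B.partEquiv p).injective)

theorem partIncl_comp_partProj : B.partIncl p ≫ B.partProj p = 𝟙 (B.part p) := by
  refine hom_ext fun k k' y y' τ _ => ⟨fun h => ?_, fun h => ?_⟩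
  · obtain ⟨b, x, τ₁, τ₂, rfl, h₁, h₂⟩ := h.of_comp
    obtain ⟨rfl, hsq₁⟩ := isGerm_inclusion_iff.1 h₁
    obtain ⟨hk, hsq₂⟩ := isGerm_ofSubmap_iff.1 h₂
    obtain rfl := (B.partEquiv p).injective (Subtype.ext hk)
    have hsq := C.sq_hcomp hsq₁ hsq₂
    rw [C.hid_comp] at hsq
    exact isGerm_id_iff.2 ⟨rfl, hsq⟩
  · obtain ⟨rfl, hsq⟩ := isGerm_id_iff.1 h
    have h₁ : IsGerm (B.partIncl p) k _ (C.hid _) := isGerm_inclusion_iff.2 ⟨rfl, C.sq_vid _⟩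
    have h₂ : IsGerm (B.partProj p) (B.partEquiv p k).1 k (C.hid _) :=
      isGerm_ofSubmap_iff.2 ⟨rfl, C.sq_vid _⟩
    exact (h₁.comp h₂).restrict (by rwa [C.hid_comp])

theorem isGerm_partProj_comp_partIncl_iff {b b' : B.Idx} {y y' : C.Ob} {τ : C.Hor y y'} :
    IsGerm (B.partProj p ≫ B.partIncl p) b b' τ ↔ p b ∧ b = b' ∧ C.Sq τ (C.hid (B.elt b)) := by
  constructor
  · intro h
    obtain ⟨k, x, τ₁, τ₂, rfl, h₁, h₂⟩ := h.of_comp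
    obtain ⟨rfl, hsq₁⟩ := isGerm_ofSubmap_iff.1 h₁
    obtain ⟨rfl, hsq₂⟩ := isGerm_inclusion_iff.1 h₂
    have hsq := C.sq_hcomp hsq₁ hsq₂
    rw [C.hid_comp] at hsq
    exact ⟨(B.partEquiv p k).2, rfl, C.sq_vcomp hsq (C.sq_hid (part_elt k).le)⟩
  · rintro ⟨hb, rfl, hsq⟩
    obtain ⟨k, hk⟩ := (B.partEquiv p).surjective ⟨b, hb⟩
    have hkb : (B.partEquiv p k).1 = b := by rw [hk]
    have h₁ : IsGerm (B.partProj p) b k (C.hid _) := isGerm_ofSubmap_iff.2 ⟨hkb, C.sq_vid _⟩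
    have h₂ : IsGerm (B.partIncl p) k b (C.hid _) := isGerm_inclusion_iff.2 ⟨hkb, C.sq_vid _⟩
    refine (h₁.comp h₂).restrict ?_
    rwa [C.hid_comp, part_elt, hkb]

theorem partProj_comp_partIncl_comp {ψ : B ⟶ D}
    (h : ∀ (b : B.Idx) (d : D.Idx) (y y' : C.Ob) (τ : C.Hor y y'), IsGerm ψ b d τ → p b) :
    B.partProj p ≫ B.partIncl p ≫ ψ = ψ := by
  rw [← Category.assoc]
  refine hom_ext fun b d y y' τ _ => ⟨fun hτ => ?_, fun hτ => ?_⟩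
  · obtain ⟨b', x, τ₁, τ₂, rfl, h₁, h₂⟩ := hτ.of_comp
    obtain ⟨-, hb, hsq⟩ := isGerm_partProj_comp_partIncl_iff.1 h₁
    have h₁' := isGerm_id_iff.2 ⟨hb, hsq⟩
    exact Category.id_comp ψ ▸ h₁'.comp h₂
  · have h₁ : IsGerm (B.partProj p ≫ B.partIncl p) b b (C.hid y) :=
      isGerm_partProj_comp_partIncl_iff.2 ⟨h _ _ _ _ _ hτ, rfl, C.sq_hid hτ.le_left⟩
    exact C.hid_comp τ ▸ h₁.comp hτ

theorem comp_partProj_comp_partIncl {ψ : D ⟶ B} (h : ∀ b, InImage ψ b → p b) :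
    ψ ≫ B.partProj p ≫ B.partIncl p = ψ := by
  refine hom_ext fun d b y y' τ _ => ⟨fun hτ => ?_, fun hτ => ?_⟩
  · obtain ⟨b', x, τ₁, τ₂, rfl, h₁, h₂⟩ := hτ.of_comp
    obtain ⟨-, hb, hsq⟩ := isGerm_partProj_comp_partIncl_iff.1 h₂
    exact Category.comp_id ψ ▸ h₁.comp (isGerm_id_iff.2 ⟨hb, hsq⟩)
  · have h₂ : IsGerm (B.partProj p ≫ B.partIncl p) b b (C.hid y') :=
      isGerm_partProj_comp_partIncl_iff.2 ⟨h b hτ.inImage, rfl, C.sq_hid hτ.le_right⟩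
    exact C.hcomp_id τ ▸ hτ.comp h₂

theorem of_inImage_of_totalAt {ψ : D ⟶ B} (h : ∀ d, TotalAt (ψ ≫ B.partProj p) d) {b : B.Idx}
    (hb : InImage ψ b) : p b := by
  obtain ⟨d, y, τ, hτ⟩ := hb.exists_isGerm le_rfl
  obtain ⟨w, hwy, hw, k, w', κ, hκ⟩ := exists_ne_bot_of_holdsLocally
    (HoldsLocally.of_le (h d) hτ.le_left) (left_ne_bot τ (B.elt_ne_bot b))
  obtain ⟨b', x, τ₁, τ₂, -, h₁, h₂⟩ := hκ.of_comp
  obtain ⟨rfl, -⟩ := hτ.exists_common_component h₁ hw hwy le_rfl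
  obtain ⟨rfl, -⟩ := isGerm_ofSubmap_iff.1 h₂
  exact (B.partEquiv p k).2

end Part

/-! ### Cofibers -/

section Cofiber

variable {A B Q : SC C}

theorem isPushout_partProj {φ : A ⟶ B} {p : B.Idx → Prop} (hp : ∀ b, p b ↔ ¬ InImage φ b)
    {Z : SC C} (hZ : IsZero Z) (f : A ⟶ Z) (g : Z ⟶ B.part p) :
    IsPushout φ f (B.partProj p) g := by
  have hZ' := isZero_iff_isEmpty.1 hZ
  have not_isGerm {D : SC C} {h : Z ⟶ D} {a d y y'} {τ : C.Hor y y'} : ¬ IsGerm (f ≫ h) a d τ :=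
    fun hτ => isEmptyElim hτ.of_comp.choose
  have comm : φ ≫ B.partProj p = f ≫ g := by
    refine hom_ext fun a k _ _ τ _ => iff_of_false (fun hτ => ?_) not_isGerm
    obtain ⟨b, _, _, _, -, h₁, h₂⟩ := hτ.of_comp
    obtain ⟨rfl, -⟩ := isGerm_ofSubmap_iff.1 h₂
    exact (hp _).1 (B.partEquiv p k).2 h₁.inImage
  refine ⟨⟨comm⟩, ⟨PushoutCocone.IsColimit.mk comm (fun s => B.partIncl p ≫ s.inl)
    (fun s => partProj_comp_partIncl_comp fun b d y y' τ hτ => (hp b).2 fun hb => ?_)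
    (fun s => hZ.eq_of_src _ _) fun s m hm _ => ?_⟩⟩
  · obtain ⟨a, w, ρ, hρ⟩ := hb.exists_isGerm hτ.le_left
    exact not_isGerm (s.condition ▸ hρ.comp hτ)
  · rw [← hm, ← Category.assoc, partIncl_comp_partProj, Category.id_comp]

theorem isCofibrationSequence_partProj {i : A ⟶ B} (hi : cof C i) {p : B.Idx → Prop}
    (hp : ∀ b, p b ↔ ¬ InImage i b) : IsCofibrationSequence (cof C) i (B.partProj p) :=
  have hZ := isZero_of_isEmpty (empty C)
  ⟨hi, empty C, hZ.from_ A, hZ.to_ _, hZ, isPushout_partProj hp hZ _ _⟩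

/-- `s` is a cofibration which is a section of the cofiber `q` of `i`, and whose image is
complementary to that of `i`. -/
structure IsCofiberSection (i : A ⟶ B) (q : B ⟶ Q) (s : Q ⟶ B) : Prop where
  section_comp : s ≫ q = 𝟙 Q
  cof_section : cof C s
  inImage_section_iff : ∀ b, InImage s b ↔ ¬ InImage i b
  comp_comp_section : ∀ {D : SC C} (ψ : D ⟶ B), (∀ d, TotalAt (ψ ≫ q) d) → ψ ≫ q ≫ s = ψ

theorem exists_isCofiberSection {i : A ⟶ B} {q : B ⟶ Q}
    (h : IsCofibrationSequence (cof C) i q) : ∃ s, IsCofiberSection i q s := by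
  obtain ⟨-, Z, f, g, hZ, hq⟩ := h
  let p (b : B.Idx) : Prop := ¬ InImage i b
  let κ := hq.isoIsPushout _ _
    (isPushout_partProj (φ := i) (p := p) (fun _ => Iff.rfl) hZ f (hZ.to_ _))
  have hκ : B.partProj p = q ≫ κ.hom := (hq.inl_isoIsPushout_hom _ _ _).symm
  refine ⟨κ.hom ≫ B.partIncl p, ?_, cof_comp (cof_of_weq (weq_of_isIso _)) cof_partIncl,
    fun b => ?_, fun ψ hψ => ?_⟩
  · have hq' : q = B.partProj p ≫ κ.inv := by rw [hκ, Category.assoc, Iso.hom_inv_id,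
      Category.comp_id]
    rw [hq', Category.assoc, ← Category.assoc (B.partIncl p), partIncl_comp_partProj,
      Category.id_comp, Iso.hom_inv_id]
  · rw [inImage_comp_iff (inImage_of_weq (weq_of_isIso _)), inImage_partIncl_iff]
  · rw [← Category.assoc q, ← hκ]
    refine comp_partProj_comp_partIncl fun b => of_inImage_of_totalAt fun d => ?_
    rw [hκ, ← Category.assoc]
    exact (hψ d).comp fun k _ _ _ _ => totalAt_of_cof (cof_of_weq (weq_of_isIso _)) k

theorem IsCofiberSection.weq_desc {i : A ⟶ B} {q : B ⟶ Q} {s : Q ⟶ B}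
    (h : IsCofiberSection i q s) (hi : cof C i) {P : SC C} {l : A ⟶ P} {r : Q ⟶ P}
    (hP : IsDisjointUnion l r) {t : P ⟶ B} (hl : l ≫ t = i) (hr : r ≫ t = s) : weq C t := by
  subst hl hr
  exact hP.weq_desc hi h.cof_section h.inImage_section_iff

theorem hasCanonicalSplittings (C : PolytopeComplex.{v, u}) :
    HasCanonicalSplittings (cof C) (weq C) := by
  intro A B Q i q hiq
  obtain ⟨s, hs⟩ := exists_isCofiberSection hiq
  refine ⟨s, hs.section_comp, fun s' hs' => ?_, hs.cof_section, fun c hc =>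
    hs.weq_desc hiq.co (isDisjointUnion_of_isColimit hc) (hc.fac _ ⟨WalkingPair.left⟩)
      (hc.fac _ ⟨WalkingPair.right⟩)⟩
  have := hs.comp_comp_section s' fun d => hs' ▸ totalAt_id d
  rw [← this, reassoc_of% hs']

theorem extensionAxiom (C : PolytopeComplex.{v, u}) : ExtensionAxiom (cof C) (weq C) := by
  intro A B Q A' B' Q' i q i' q' a b c h h' hab hbc ha hc
  obtain ⟨s, hs⟩ := exists_isCofiberSection h
  obtain ⟨s', hs'⟩ := exists_isCofiberSection h'
  obtain ⟨P, l, r, hP⟩ := exists_isDisjointUnion A Q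
  obtain ⟨P', l', r', hP'⟩ := exists_isDisjointUnion A' Q'
  obtain ⟨t, hlt, hrt⟩ := hP.exists_desc i s
  obtain ⟨t', hlt', hrt'⟩ := hP'.exists_desc i' s'
  obtain ⟨d, hld, hrd⟩ := hP.exists_desc (a ≫ l') (c ≫ r')
  have hsb : s ≫ b = c ≫ s' := by
    have hsbq : (s ≫ b) ≫ q' = c := by
      rw [Category.assoc, ← hbc, reassoc_of% hs.section_comp]
    rw [← hs'.comp_comp_section (s ≫ b) fun k => hsbq ▸ totalAt_of_cof (cof_of_weq hc) k,
      ← Category.assoc, hsbq]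
  have htb : t ≫ b = d ≫ t' := by
    apply hP.hom_ext
    · rw [reassoc_of% hlt, reassoc_of% hld, hlt', hab]
    · rw [reassoc_of% hrt, reassoc_of% hrd, hrt', hsb]
  refine weq_of_precomp (hs.weq_desc h.co hP hlt hrt) ?_
  rw [htb]
  exact weq_comp (hP.weq_of_comm hP' hld hrd ha hc) (hs'.weq_desc h'.co hP' hlt' hrt')

end Cofiber

end SC

namespace SC

open PolytopeComplex

variable {C : PolytopeComplex.{v, u}}

/-! ### Maximal refinements -/

section MaximalRefinement

/-- The preimage of `y` under `σ` exists and is contained in `t`. -/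
def PullLE {a b : C.Ob} (σ : C.Hor a b) (t y : C.Ob) : Prop :=
  ∃ (w : C.Ob) (κ : C.Hor w y), C.Sq κ σ ∧ w ≤ t

theorem exists_le_iff_pullLE {a b c t : C.Ob} (σ : C.Hor a b) (ha : a ≤ c) (ht : t ≤ c) :
    ∃ m ≤ b, ∀ (D : PolytopeComplex.{v, u}) (F : C ⟶ D) (y : D.Ob),
      y ≤ F.obj m ↔ PullLE (F.hmap σ) (F.obj t) y := by
  obtain ⟨d, hd⟩ := C.exists_pullback ha ht
  obtain ⟨hda, hdt⟩ := (isGLB_pair_iff.1 hd d).1 le_rfl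
  obtain ⟨m, τ, hτ⟩ := exists_sq_of_le_left σ hda
  refine ⟨m, C.sq_right hτ, fun D F y => ⟨fun hy => ?_, fun ⟨w, κ, hκ, hw⟩ => ?_⟩⟩
  · obtain ⟨w, κ, hκ⟩ := D.exists_sq (F.hmap τ) hy
    exact ⟨w, κ, D.sq_vcomp hκ (F.sq hτ), (D.sq_left hκ).trans (F.mono hdt)⟩
  · have hwd : w ≤ F.obj d :=
      (isGLB_pair_iff.1 (F.map_pullback ha ht hd) w).2 ⟨D.sq_left hκ, hw⟩
    exact D.sq_right (sq_of_left_le hκ (F.sq hτ) hwd)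

theorem exists_le_iff_of_finite {b : C.Ob} {ι : Type*} [Finite ι] (m : ι → C.Ob)
    (hm : ∀ i, m i ≤ b) :
    ∃ n ≤ b, ∀ (D : PolytopeComplex.{v, u}) (F : C ⟶ D) (y : D.Ob),
      y ≤ F.obj n ↔ y ≤ F.obj b ∧ ∀ i, y ≤ F.obj (m i) := by
  suffices h : ∀ s : Finset ι, ∃ n ≤ b, ∀ (D : PolytopeComplex.{v, u}) (F : C ⟶ D) (y : D.Ob),
      y ≤ F.obj n ↔ y ≤ F.obj b ∧ ∀ i ∈ s, y ≤ F.obj (m i) by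
    have := Fintype.ofFinite ι
    simpa using h Finset.univ
  classical
  intro s
  induction s using Finset.induction_on with
  | empty => exact ⟨b, le_rfl, by simp⟩
  | insert i s _ ih =>
    obtain ⟨n, hn, hs⟩ := ih
    obtain ⟨d, hd⟩ := C.exists_pullback (hm i) hn
    refine ⟨d, (hd.1 (by simp)).trans (hm i), fun D F y => ?_⟩
    rw [isGLB_pair_iff.1 (F.map_pullback (hm i) hn hd) y, hs]
    simp [and_left_comm]

variable {A B X : SC C}

theorem exists_le_iff_forall_pullLE (S : Span A X) (x : X.Idx) (t : {s // S.f s = x} → C.Ob)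
    (ht : ∀ s, t s ≤ A.elt (S.p s)) :
    ∃ m ≤ X.elt x, ∀ (D : PolytopeComplex.{v, u}) (F : C ⟶ D) (y : D.Ob),
      y ≤ F.obj m ↔ y ≤ F.obj (X.elt x) ∧ ∀ s, PullLE (F.hmap (S.hor s.1)) (F.obj (t s)) y := by
  choose m hm hm' using fun s => exists_le_iff_pullLE (S.hor s.1) (S.sub.le s.1) (ht s)
  obtain ⟨n, hn, hn'⟩ := exists_le_iff_of_finite m fun s => (hm s).trans_eq (by rw [s.2])
  exact ⟨n, hn, fun D F y => (hn' D F y).trans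
    (and_congr_right fun _ => forall_congr' fun s => hm' s D F y)⟩

theorem exists_isSubmap_pullLE (S : Span A X) (Q : Span A B) :
    ∃ (P : SC C) (p : P.Idx → X.Idx), IsSubmap P.elt X.elt p ∧
      ∀ (D : PolytopeComplex.{v, u}) (F : C ⟶ D) (x : X.Idx) (y : D.Ob), y ≠ D.bot →
        ((∃ k, p k = x ∧ y ≤ F.obj (P.elt k)) ↔ y ≤ F.obj (X.elt x) ∧ ∀ s, S.f s = x →
          ∃ k, Q.p k = S.p s ∧ PullLE (F.hmap (S.hor s)) (F.obj (Q.apex.elt k)) y) := by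
  let Choice (x : X.Idx) := ∀ s : {s // S.f s = x}, {k // Q.p k = S.p s.1}
  choose m hmle hm using fun z : Σ x, Choice x => exists_le_iff_forall_pullLE S z.1
    (fun s => Q.apex.elt (z.2 s).1) fun s => (Q.sub.le _).trans_eq (by rw [(z.2 s).2])
  have choice_eq {z z' : Σ x, Choice x} (h : z.1 = z'.1) {w : C.Ob} (hw : w ≠ C.bot)
      (hz : w ≤ m z) (hz' : w ≤ m z') : z = z' := by
    obtain ⟨x, c⟩ := z
    obtain ⟨_, c'⟩ := z'
    obtain rfl := h
    congr 1
    funext s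
    obtain ⟨y, κ, hκ, hy⟩ := ((hm _ C (𝟙 C) w).1 hz).2 s
    obtain ⟨y', κ', hκ', hy'⟩ := ((hm _ C (𝟙 C) w).1 hz').2 s
    exact Subtype.ext (Q.eq_of_le ((c s).2.trans (c' s).2.symm) (left_ne_bot κ hw) hy
      ((C.sq_left (C.sq_unique hκ hκ')).trans hy'))
  obtain ⟨P, e, he⟩ := exists_family (I := {z // m z ≠ C.bot}) (fun z => m z.1) fun z => z.2
  refine ⟨P, fun k => (e k).1.1, isSubmap_of_eq (fun k => (he k).trans_le (hmle _))
    fun k k' w hw hp hk hk' => e.injective (Subtype.ext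
      (choice_eq hp hw (by rwa [← he]) (by rwa [← he]))), fun D F x y hy => ⟨?_, ?_⟩⟩
  · rintro ⟨k, rfl, hyk⟩
    rw [he, hm] at hyk
    exact ⟨hyk.1, fun s hs => ⟨_, ((e k).1.2 ⟨s, hs⟩).2, hyk.2 ⟨s, hs⟩⟩⟩
  · rintro ⟨hyx, hys⟩
    choose k hk hk' using hys
    let z : Σ x, Choice x := ⟨x, fun s => ⟨k s.1 s.2, hk s.1 s.2⟩⟩
    have hz : y ≤ F.obj (m z) := (hm z D F y).2 ⟨hyx, fun s => hk' s.1 s.2⟩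
    refine ⟨e.symm ⟨z, fun h => hy (D.eq_bot ?_)⟩, by simp [z], by simpa [he] using hz⟩
    rwa [h, F.map_bot] at hz

theorem forall_definedOn_map_iff {D : PolytopeComplex.{v, u}} (F : C ⟶ D) (S : Span A X)
    (Q : Span A B) {x : (mapObj F X).Idx} {y : D.Ob} (hy : y ≠ D.bot)
    (hyx : y ≤ F.obj (X.elt (idxIncl F X x))) :
    (∀ (a : (mapObj F A).Idx) (w : D.Ob) (κ : D.Hor w y),
      IsGerm ((map F).map S.hom) a x κ → DefinedOn ((map F).map Q.hom) a w) ↔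
    ∀ s, S.f s = idxIncl F X x →
      ∃ k, Q.p k = S.p s ∧ PullLE (F.hmap (S.hor s)) (F.obj (Q.apex.elt k)) y := by
  constructor
  · intro h s hs
    obtain ⟨w, κ, hκ⟩ := D.exists_sq (F.hmap (S.hor s)) (hyx.trans_eq (by rw [hs]))
    have hw := left_ne_bot κ hy
    obtain ⟨a, ha⟩ := exists_idxIncl_eq F
      (ne_bot_of_le ((D.sq_left hκ).trans (F.mono (S.sub.le s))) hw)
    obtain ⟨z, hz, hwz⟩ := (definedOn_map_iff F hw).1
      (h a w κ ((isGerm_map_iff F hw).2 ⟨_, _, _, ⟨s, ha.symm, hs, C.sq_vid _⟩, hκ⟩))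
    obtain ⟨⟨k, hk⟩, hzk⟩ := Q.definedOn_hom_iff.1 hz
    exact ⟨k, hk.trans ha, w, κ, hκ, hwz.trans (F.mono hzk)⟩
  · intro h a w κ hκ
    have hw := left_ne_bot κ hy
    obtain ⟨z, z', ρ, ⟨s, hp, hf, hs⟩, hsq⟩ := (isGerm_map_iff F hw).1 hκ
    obtain ⟨k, hk, w', κ', hκ', hwk⟩ := h s hf
    exact (definedOn_map_iff F hw).2 ⟨_, Q.definedOn_hom_iff.2 ⟨⟨k, hk.trans hp⟩, le_rfl⟩,
      (D.sq_left (D.sq_unique (D.sq_vcomp hsq (F.sq hs)) hκ')).trans hwk⟩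

/-- `j : X ⟶ P` is defined exactly on those `y` whose preimages under the germs of `f : A ⟶ X` lie
in the domain of definition of `θ : A ⟶ B`. For weak equivalences `θ` and `j` this makes `P` the
largest refinement of `X` along which `f` lifts to `B`. -/
def IsMaximalRefinement (θ : A ⟶ B) (f : A ⟶ X) {P : SC C} (j : X ⟶ P) : Prop :=
  ∀ (x : X.Idx) (y : C.Ob), y ≠ C.bot → (DefinedOn j x y ↔ y ≤ X.elt x ∧
    ∀ (a : A.Idx) (w : C.Ob) (κ : C.Hor w y), IsGerm f a x κ → DefinedOn θ a w)

/-- The property of a refinement `j` to be maximal, and to remain so under polytope functors. -/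
def IsUniversallyMaximal (θ : A ⟶ B) (f : A ⟶ X) {P : SC C} (j : X ⟶ P) : Prop :=
  ∀ (D : PolytopeComplex.{v, u}) (F : C ⟶ D),
    IsMaximalRefinement ((map F).map θ) ((map F).map f) ((map F).map j)

theorem IsUniversallyMaximal.isMaximalRefinement {P : SC C} {θ : A ⟶ B} {f : A ⟶ X} {j : X ⟶ P}
    (h : IsUniversallyMaximal θ f j) : IsMaximalRefinement θ f j := by
  have := h C (𝟙 C)
  rwa [map_id] at this

theorem IsMaximalRefinement.totalAt {P : SC C} {θ : A ⟶ B} {f : A ⟶ X} {j : X ⟶ P}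
    (h : IsMaximalRefinement θ f j) (hθ : ∀ a, TotalAt θ a) (x : X.Idx) : TotalAt j x := by
  obtain ⟨S, rfl⟩ := exists_span f
  have hpull (s : {s // S.f s = x}) : HoldsLocally C.J (X.elt x) fun y =>
      ∃ (w : C.Ob) (κ : C.Hor y w), C.Sq κ (C.hinv (S.hor s.1)) ∧ DefinedOn θ (S.p s.1) w := by
    obtain ⟨s, rfl⟩ := s
    exact (hθ (S.p s)).holdsLocally_pull (C.hinv (S.hor s)) (S.sub.le s)
  refine holdsLocally_of_ne_bot (X.elt_ne_bot x) (fun _ _ hyz hz => hz.of_le hyz)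
    ((HoldsLocally.forall_of_finite hpull).mono fun y hyx hy hne => (h x y hne).2 ⟨hyx, ?_⟩)
  rintro a w κ ⟨s, rfl, hf, hs⟩
  obtain ⟨w', κ', hκ', hw'⟩ := hy ⟨s, hf⟩
  exact hw'.of_le (C.sq_left (C.sq_unique hs (sq_hinv_left hκ')))

theorem exists_isUniversallyMaximal {θ : A ⟶ B} (hθ : ∀ a, TotalAt θ a) (f : A ⟶ X) :
    ∃ (P : SC C) (j : X ⟶ P), weq C j ∧ IsUniversallyMaximal θ f j := by
  obtain ⟨S, rfl⟩ := exists_span f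
  obtain ⟨Q, rfl⟩ := exists_span θ
  obtain ⟨P, p, hp, hP⟩ := exists_isSubmap_pullLE S Q
  have hj : IsUniversallyMaximal Q.hom S.hom (ofSubmap hp) := by
    intro D F x y hy
    refine (definedOn_map_iff F hy).trans (Iff.trans ⟨?_, ?_⟩ ((hP D F _ y hy).trans
      (and_congr_right fun hyx => (forall_definedOn_map_iff F S Q hy hyx).symm)))
    · rintro ⟨z, hz, hyz⟩
      obtain ⟨k, hk, hzk⟩ := definedOn_ofSubmap_iff.1 hz
      exact ⟨k, hk, hyz.trans (F.mono hzk)⟩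
    · rintro ⟨k, hk, hyk⟩
      exact ⟨_, definedOn_ofSubmap_iff.2 ⟨k, hk, le_rfl⟩, hyk⟩
  exact ⟨P, ofSubmap hp, weq_ofSubmap (hj.isMaximalRefinement.totalAt hθ), hj⟩

namespace IsMaximalRefinement

variable {P : SC C} {θ : A ⟶ B} {f : A ⟶ X} {j : X ⟶ P}

theorem exists_comp_eq (h : IsMaximalRefinement θ f j) (hθ : weq C θ) :
    ∃ g : B ⟶ P, θ ≫ g = f ≫ j := by
  refine SC.exists_comp_eq (injAt_of_cof (cof_of_weq hθ)) fun a y hy ⟨k, z, τ, hτ⟩ => ?_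
  obtain ⟨x, y', τ₁, τ₂, -, h₁, h₂⟩ := hτ.of_comp
  exact ((h x y' (right_ne_bot τ₁ hy)).1 h₂.definedOn).2 a y τ₁ h₁

theorem isPushout (h : IsMaximalRefinement θ f j) (hθ : weq C θ) (hj : weq C j) {g : B ⟶ P}
    (comm : θ ≫ g = f ≫ j) : IsPushout θ f g j := by
  have exists_desc (s : PushoutCocone θ f) : ∃ t : P ⟶ s.pt, j ≫ t = s.inr := by
    refine SC.exists_comp_eq (injAt_of_cof (cof_of_weq hj)) fun x y hy hxy =>
      (h x y hy).2 ⟨?_, fun a w κ hκ => ?_⟩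
    · obtain ⟨_, _, _, hτ⟩ := hxy
      exact hτ.le_left
    · obtain ⟨_, _, _, hτ⟩ := hxy
      exact (s.condition ▸ hκ.comp hτ).definedOn.of_comp
  choose t ht using exists_desc
  refine ⟨⟨comm⟩, ⟨PushoutCocone.IsColimit.mk comm t (fun s => ?_) ht fun s m _ hm =>
    hom_ext_of_inImage (inImage_of_weq hj) (hm.trans (ht s).symm)⟩⟩
  refine hom_ext_of_inImage (inImage_of_weq hθ) ?_
  rw [reassoc_of% comm, ht, s.condition]

end IsMaximalRefinement

theorem IsUniversallyMaximal.isPushout_map {P : SC C} {θ : A ⟶ B} {f : A ⟶ X} {j : X ⟶ P}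
    (h : IsUniversallyMaximal θ f j) (hθ : weq C θ) (hj : weq C j) {g : B ⟶ P}
    (comm : θ ≫ g = f ≫ j) {D : PolytopeComplex.{v, u}} (F : C ⟶ D) :
    IsPushout ((map F).map θ) ((map F).map f) ((map F).map g) ((map F).map j) :=
  (h D F).isPushout (weq_map F hθ) (weq_map F hj) (by rw [← Functor.map_comp, comm,
    Functor.map_comp])

end MaximalRefinement

end SC

namespace SC

open PolytopeComplex

variable {C : PolytopeComplex.{v, u}}

/-! ### The Waldhausen structure -/

section Pushout

variable {A B X P : SC C} {i : A ⟶ B} {f : A ⟶ X} {g : B ⟶ P} {j : X ⟶ P}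

theorem exists_isPushout (hi : cof C i) (f : A ⟶ X) :
    ∃ (P : SC C) (g : B ⟶ P) (j : X ⟶ P), IsPushout i f g j ∧
      (∀ (D : PolytopeComplex.{v, u}) (F : C ⟶ D),
        IsPushout ((map F).map i) ((map F).map f) ((map F).map g) ((map F).map j)) ∧
      ∃ (Y : SC C) (l : X ⟶ Y) (r : B.part (¬ InImage i ·) ⟶ Y) (t : Y ⟶ P),
        IsDisjointUnion l r ∧ weq C t ∧ l ≫ t = j ∧ r ≫ t = B.partIncl _ ≫ g := by
  obtain ⟨U, lA, rA, hU⟩ := exists_isDisjointUnion A (B.part (¬ InImage i ·))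
  obtain ⟨Y, l, r, hY⟩ := exists_isDisjointUnion X (B.part (¬ InImage i ·))
  obtain ⟨θ, rfl, hrθ⟩ := hU.exists_desc i (B.partIncl _)
  obtain ⟨f', hlf, hrf⟩ := hU.exists_desc (f ≫ l) r
  have hθ : weq C θ := hU.weq_desc hi (hrθ ▸ cof_partIncl) fun b => by
    rw [hrθ, inImage_partIncl_iff]
  obtain ⟨P, t, ht, hmax⟩ := exists_isUniversallyMaximal
    (fun a => totalAt_of_cof (cof_of_weq hθ) a) f'
  obtain ⟨g, hg⟩ := hmax.isMaximalRefinement.exists_comp_eq hθ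
  have isPushout_map (D : PolytopeComplex.{v, u}) (F : C ⟶ D) : IsPushout
      ((map F).map (lA ≫ θ)) ((map F).map f) ((map F).map g) ((map F).map (l ≫ t)) := by
    rw [Functor.map_comp, Functor.map_comp]
    refine IsPushout.paste_horiz ?_ (hmax.isPushout_map hθ ht hg F)
    exact (hU.map F).isPushout (hY.map F) (by rw [← Functor.map_comp, hlf, Functor.map_comp])
      (by rw [← Functor.map_comp, hrf])
  refine ⟨P, g, l ≫ t, ?_, isPushout_map, Y, l, r, t, hY, ht, rfl, ?_⟩
  · have := isPushout_map C (𝟙 C)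
    rwa [map_id] at this
  · rw [← hrf, Category.assoc, ← hg, reassoc_of% hrθ]

theorem exists_weq_of_isPushout (hi : cof C i) (h : IsPushout i f g j) :
    ∃ (Y : SC C) (l : X ⟶ Y) (r : B.part (¬ InImage i ·) ⟶ Y) (t : Y ⟶ P),
      IsDisjointUnion l r ∧ weq C t ∧ l ≫ t = j ∧ r ≫ t = B.partIncl _ ≫ g := by
  obtain ⟨P₀, g₀, j₀, h₀, -, Y, l, r, t, hY, ht, hl, hr⟩ := exists_isPushout hi f
  refine ⟨Y, l, r, t ≫ (h₀.isoIsPushout _ _ h).hom, hY, weq_comp ht (weq_of_isIso _), ?_, ?_⟩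
  · rw [reassoc_of% hl, IsPushout.inr_isoIsPushout_hom]
  · rw [reassoc_of% hr, IsPushout.inl_isoIsPushout_hom]

theorem isPushout_map (hi : cof C i) (h : IsPushout i f g j) {D : PolytopeComplex.{v, u}}
    (F : C ⟶ D) :
    IsPushout ((map F).map i) ((map F).map f) ((map F).map g) ((map F).map j) := by
  obtain ⟨P₀, g₀, j₀, h₀, hF, -⟩ := exists_isPushout hi f
  refine (hF D F).of_iso (Iso.refl _) (Iso.refl _) (Iso.refl _)
    ((map F).mapIso (h₀.isoIsPushout _ _ h)) (by simp) (by simp) ?_ ?_ <;>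
  simp [← Functor.map_comp]

theorem cof_of_isPushout (hi : cof C i) (h : IsPushout i f g j) : cof C j := by
  obtain ⟨Y, l, r, t, hY, ht, rfl, -⟩ := exists_weq_of_isPushout hi h
  exact cof_comp hY.cof_left (cof_of_weq ht)

end Pushout

section Gluing

variable {A B X P A' B' X' P' : SC C} {i : A ⟶ B} {f : A ⟶ X} {g : B ⟶ P} {j : X ⟶ P}
  {i' : A' ⟶ B'} {f' : A' ⟶ X'} {g' : B' ⟶ P'} {j' : X' ⟶ P'} {a : A ⟶ A'} {b : B ⟶ B'}
  {x : X ⟶ X'} {t : P ⟶ P'}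

theorem inImage_iff_of_comm (hab : i ≫ b = a ≫ i') (ha : weq C a) (hb : weq C b) {k : B.Idx}
    {k' : B'.Idx} {y y' : C.Ob} {τ : C.Hor y y'} (hτ : IsGerm b k k' τ) :
    InImage i k ↔ InImage i' k' := by
  rw [← inImage_comp_iff (inImage_of_weq ha), ← hab,
    (injAt_of_cof (cof_of_weq hb) k').inImage_comp_iff hτ]

theorem exists_weq_part (hb : weq C b) {p : B.Idx → Prop} {p' : B'.Idx → Prop}
    (hp : ∀ (k : B.Idx) (k' : B'.Idx) (y y' : C.Ob) (τ : C.Hor y y'),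
      IsGerm b k k' τ → (p k ↔ p' k')) :
    ∃ c : B.part p ⟶ B'.part p', weq C c ∧ B.partIncl p ≫ b = c ≫ B'.partIncl p' := by
  have hc : (B.partIncl p ≫ b ≫ B'.partProj p') ≫ B'.partIncl p' = B.partIncl p ≫ b := by
    rw [Category.assoc, Category.assoc, ← Category.assoc]
    refine comp_partProj_comp_partIncl fun k' ⟨_, _, _, _, hk'⟩ => ?_
    obtain ⟨k, _, _, _, -, h₁, h₂⟩ := hk'.of_comp
    exact (hp _ _ _ _ _ h₂).1 (inImage_partIncl_iff.1 h₁.inImage)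
  have cof_incl_b := cof_comp (cof_partIncl (p := p)) (cof_of_weq hb)
  refine ⟨_, weq_iff.2 ⟨cof_of_postcomp cof_partIncl (hc ▸ cof_incl_b), fun m => ?_⟩, hc.symm⟩
  have hm : DefinedOn (B'.partIncl p') m _ := definedOn_inclusion m
  obtain ⟨k', _, ρ, hρ⟩ := hm
  obtain ⟨k, _, _, _, hk⟩ := inImage_of_weq hb k'
  have := inImage_partIncl_iff.2 ((hp _ _ _ _ _ hk).2 (inImage_partIncl_iff.1 hρ.inImage))
  rw [← (injAt_of_cof cof_partIncl k').inImage_comp_iff hρ, hc]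
  exact this.comp hk

theorem weq_of_isPushout (h : IsPushout i f g j) (h' : IsPushout i' f' g' j') (hi : cof C i)
    (hi' : cof C i') (hab : i ≫ b = a ≫ i') (hgt : g ≫ t = b ≫ g') (hjt : j ≫ t = x ≫ j')
    (ha : weq C a) (hb : weq C b) (hx : weq C x) : weq C t := by
  obtain ⟨Y, l, r, s, hY, hs, rfl, hr⟩ := exists_weq_of_isPushout hi h
  obtain ⟨Y', l', r', s', hY', hs', rfl, hr'⟩ := exists_weq_of_isPushout hi' h'
  obtain ⟨c, hc, hcb⟩ := exists_weq_part hb fun k k' y y' τ hτ =>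
    not_congr (inImage_iff_of_comm hab ha hb hτ)
  obtain ⟨d, hld, hrd⟩ := hY.exists_desc (x ≫ l') (c ≫ r')
  have hd : weq C d := hY.weq_of_comm hY' hld hrd hx hc
  have hst : s ≫ t = d ≫ s' := by
    apply hY.hom_ext
    · rw [← Category.assoc, hjt, reassoc_of% hld]
    · rw [reassoc_of% hr, hgt, reassoc_of% hcb, reassoc_of% hrd, hr']
  exact weq_of_precomp hs (hst ▸ weq_comp hd hs')

end Gluing

theorem isWaldhausen (C : PolytopeComplex.{v, u}) : IsWaldhausen (cof C) (weq C) where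
  hasZero := ⟨empty C, isZero_of_isEmpty _⟩
  co_mul := cof_isMultiplicative C
  w_mul := weq_isMultiplicative C
  co_of_iso _ _ := cof_of_weq (weq_of_isIso _)
  w_of_iso _ _ := weq_of_isIso _
  co_of_zero _ hZ := cof_of_isZero hZ _
  hasPushout _ f hi :=
    have ⟨_, _, _, h, _⟩ := exists_isPushout hi f
    h.hasPushout
  co_pushout h hi := cof_of_isPushout hi h
  gluing h h' hi hi' hab _ hgt hjt ha hb hx := weq_of_isPushout h h' hi hi' hab hgt hjt ha hb hx

theorem isExactFunctor_map {C D : PolytopeComplex.{v, u}} (F : C ⟶ D) :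
    IsExactFunctor (cof C) (weq C) (cof D) (weq D) (map F) where
  map_zero hZ := isZero_iff_isEmpty.2 ⟨fun i => (isZero_iff_isEmpty.1 hZ).false (idxIncl F _ i)⟩
  map_co _ := cof_map F
  map_w _ := weq_map F
  map_pushout h hi := isPushout_map hi h F

/-- The Waldhausen categories `SC(C)` and the exact functors `SC(F)`. -/
noncomputable def waldFunctor : PolytopeComplex.{v, u} ⥤ WaldCat.{max u v, u} where
  obj C := { SC.functor.obj C with isWaldhausen := isWaldhausen C }
  map F := ⟨map F, isExactFunctor_map F⟩
  map_id C := Subtype.ext (map_id C)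
  map_comp F G := Subtype.ext (map_comp F G)

theorem waldFunctor_comp_forget : waldFunctor.{v, u} ⋙ WaldCat.forget = SC.functor := rfl

end SC

namespace SC

open PolytopeComplex

variable {C : PolytopeComplex.{v, u}}

/-! ### The group `K₀` -/

section K0

/-- The member of a family with a given index, as a polytope. -/
def polytope (A : SC C) (i : A.Idx) : C.Polytope := ⟨A.elt i, i.2⟩

noncomputable instance (A : SC C) : Fintype A.Idx := Fintype.ofFinite _

/-- The index of the only member of `{a}`. -/
noncomputable def singleIdx (a : C.Polytope) : (single a).Idx := ⟨0, a.2⟩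

noncomputable instance (a : C.Polytope) : Unique (single a).Idx where
  default := singleIdx a
  uniq i := Subtype.ext (by_contra fun h => i.2 (if_neg h))

theorem single_elt {a : C.Polytope} (i : (single a).Idx) : (single a).elt i = a.1 := by
  rw [Unique.eq_default i]
  rfl

variable {A B Q : SC C}

theorem k0_eq_of_weq {φ : A ⟶ B} (h : weq C φ) :
    K0.of (cof C) (weq C) A = K0.of (cof C) (weq C) B :=
  QuotientAddGroup.eq_iff_sub_mem.2 (AddSubgroup.subset_closure (K0Rel.weq φ h))

theorem k0_eq_add {i : A ⟶ B} {q : B ⟶ Q} (h : IsCofibrationSequence (cof C) i q) :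
    K0.of (cof C) (weq C) B = K0.of (cof C) (weq C) A + K0.of (cof C) (weq C) Q :=
  QuotientAddGroup.eq_iff_sub_mem.2 (AddSubgroup.subset_closure (K0Rel.cof i q h))

theorem k0_of_isZero (h : IsZero A) : K0.of (cof C) (weq C) A = 0 :=
  left_eq_add.1 (k0_eq_add (i := 𝟙 A) (q := 𝟙 A)
    ⟨cof_of_isZero h _, A, 𝟙 A, 𝟙 A, h, IsPushout.of_id_fst⟩)

theorem k0_eq_single_add_part (A : SC C) (i₀ : A.Idx) :
    K0.of (cof C) (weq C) A = K0.of (cof C) (weq C) (single (A.polytope i₀)) +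
      K0.of (cof C) (weq C) (A.part (· ≠ i₀)) := by
  have single_elt_eq (k : (single (A.polytope i₀)).Idx) :
      (single (A.polytope i₀)).elt k = A.elt i₀ := single_elt k
  refine k0_eq_add (isCofibrationSequence_partProj (cof_inclusion (f := fun _ => i₀)
    (h := single_elt_eq) (Function.injective_of_subsingleton _)) fun i => ?_)
  rw [inImage_inclusion_iff, exists_const, ne_comm]

theorem k0_eq_sum (A : SC C) :
    K0.of (cof C) (weq C) A = ∑ i, K0.of (cof C) (weq C) (single (A.polytope i)) := by
  classical
  induction hn : Fintype.card A.Idx generalizing A with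
  | zero =>
    have := Fintype.card_eq_zero_iff.1 hn
    rw [k0_of_isZero (isZero_of_isEmpty A), Fintype.sum_empty]
  | succ n ih =>
    obtain ⟨i₀⟩ : Nonempty A.Idx := Fintype.card_pos_iff.1 (by omega)
    have hcard : Fintype.card (A.part (· ≠ i₀)).Idx = n := by
      rw [Fintype.card_congr (A.partEquiv _), Fintype.card_subtype_compl, hn,
        Fintype.card_subtype_eq, Nat.add_sub_cancel]
    have polytope_part (k) :
        (A.part (· ≠ i₀)).polytope k = A.polytope (A.partEquiv _ k).1 := Subtype.ext (part_elt k)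
    rw [k0_eq_single_add_part A i₀, ih _ hcard, Fintype.sum_eq_add_sum_subtype_ne _ i₀]
    simp only [polytope_part]
    rw [(A.partEquiv _).sum_comp fun b => K0.of (cof C) (weq C) (single (A.polytope b.1))]

theorem k0_single_eq_of_hor {a b : C.Polytope} (σ : C.Hor a.1 b.1) :
    K0.of (cof C) (weq C) (single a) = K0.of (cof C) (weq C) (single b) :=
  k0_eq_of_weq (weq_shuffle (f := fun _ => default)
    (Function.bijective_iff_existsUnique _ |>.2 fun _ =>
      ⟨default, Subsingleton.elim _ _, fun _ _ => Subsingleton.elim _ _⟩)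
    fun i => C.hcomp (horOfEq (single_elt i)) σ)

theorem k0_single_eq_sum {I : Type} [Fintype I] {x : I → C.Polytope} {a : C.Polytope}
    (h : IsCoveringSubmap (fun i => (x i).1) (fun _ : Unit => a.1) fun _ => ()) :
    K0.of (cof C) (weq C) (single a) = ∑ i, K0.of (cof C) (weq C) (single (x i)) := by
  obtain ⟨T, e, he⟩ := exists_family (fun i => (x i).1) fun i => (x i).2
  have polytope_eq (k) : T.polytope k = x (e k) := Subtype.ext (he k)
  have hp : IsSubmap T.elt (single a).elt fun _ => default := by
    refine ⟨fun k => ?_, fun k k' hk _ => ?_⟩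
    · rw [he, single_elt]
      exact h.le _
    · rw [he, he]
      exact h.disjoint _ _ (e.injective.ne hk) rfl
  have htotal (i) : TotalAt (ofSubmap hp) i := by
    unfold TotalAt
    rw [single_elt]
    refine (isCoveringFamily_iff.1 (h.cover ())).2.mono fun y _ ⟨s, hs⟩ => ?_
    exact definedOn_ofSubmap_iff.2 ⟨e.symm s.1, Subsingleton.elim _ _, by simpa [he] using hs⟩
  rw [k0_eq_of_weq (weq_ofSubmap htotal), k0_eq_sum]
  simp only [polytope_eq]
  exact e.sum_comp fun i => K0.of (cof C) (weq C) (single (x i))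

theorem scissors_eq_of_hor {a b : C.Polytope} (σ : C.Hor a.1 b.1) :
    ScissorsGroup.of a = ScissorsGroup.of b :=
  QuotientAddGroup.eq_iff_sub_mem.2 (AddSubgroup.subset_closure (ScissorsRel.hor a b σ))

theorem scissors_eq_sum {I : Type} [Fintype I] {x : I → C.Polytope} {a : C.Polytope}
    (h : IsCoveringSubmap (fun i => (x i).1) (fun _ : Unit => a.1) fun _ => ()) :
    ScissorsGroup.of a = ∑ i, ScissorsGroup.of (x i) :=
  (QuotientAddGroup.eq_iff_sub_mem.2 (AddSubgroup.subset_closure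
    (k := {x | ScissorsRel C x}) (ScissorsRel.cover x a h))).trans
      (map_sum (QuotientAddGroup.mk' _) _ _)

/-- The sum of the classes of the members of a family, in the scissors congruence group. -/
noncomputable def scissorsClass (A : SC C) : ScissorsGroup C :=
  ∑ i, ScissorsGroup.of (A.polytope i)

theorem scissorsClass_eq_sum_span (S : Span A B)
    (h : IsCoveringSubmap S.apex.elt A.elt S.p) :
    scissorsClass A = ∑ s, ScissorsGroup.of (B.polytope (S.f s)) := by
  classical
  have eq_sum_fiber (i) : ScissorsGroup.of (A.polytope i) =
      ∑ s : {s // S.p s = i}, ScissorsGroup.of (S.apex.polytope s.1) := by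
    refine scissors_eq_sum ⟨⟨?_, ?_⟩, fun _ => ?_⟩
    · rintro ⟨s, rfl⟩
      exact h.le s
    · rintro ⟨s, hs⟩ ⟨s', hs'⟩ hne -
      exact h.disjoint s s' (fun h => hne (Subtype.ext h)) (hs.trans hs'.symm)
    · obtain ⟨hle, hlocal⟩ := isCoveringFamily_iff.1 (h.cover i)
      exact isCoveringFamily_iff.2 ⟨fun s => hle s.1, hlocal.mono fun y _ ⟨s, hs⟩ =>
        ⟨⟨s, rfl⟩, hs⟩⟩
  simp only [scissorsClass, eq_sum_fiber]
  rw [Fintype.sum_fiberwise S.p fun s => ScissorsGroup.of (S.apex.polytope s)]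
  exact Fintype.sum_congr _ _ fun s => scissors_eq_of_hor (S.hor s)

open scoped Classical in
theorem scissorsClass_eq_sum_inImage {φ : A ⟶ B} (h : cof C φ) :
    scissorsClass A = ∑ b with InImage φ b, ScissorsGroup.of (B.polytope b) := by
  obtain ⟨S, rfl, hcover, hinj⟩ := h
  rw [scissorsClass_eq_sum_span S hcover,
    ← Finset.sum_image (f := fun b => ScissorsGroup.of (B.polytope b)) hinj.injOn]
  congr 1
  ext b
  simp [Span.inImage_hom_iff]

theorem scissorsClass_eq_of_weq {φ : A ⟶ B} (h : weq C φ) :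
    scissorsClass A = scissorsClass B := by
  classical
  rw [scissorsClass_eq_sum_inImage (cof_of_weq h),
    Finset.filter_true_of_mem fun b _ => inImage_of_weq h b, scissorsClass]

theorem scissorsClass_eq_add {i : A ⟶ B} {q : B ⟶ Q} (h : IsCofibrationSequence (cof C) i q) :
    scissorsClass B = scissorsClass A + scissorsClass Q := by
  classical
  obtain ⟨s, hs⟩ := exists_isCofiberSection h
  rw [scissorsClass_eq_sum_inImage h.co, scissorsClass_eq_sum_inImage hs.cof_section]
  simp only [hs.inImage_section_iff]
  exact (Finset.sum_filter_add_sum_filter_not _ _ _).symm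

theorem scissorsClass_single (a : C.Polytope) : scissorsClass (single a) = ScissorsGroup.of a :=
  Fintype.sum_unique _

/-- The homomorphism `[a] ↦ [{a}]` from the scissors congruence group to `K₀`. -/
noncomputable def scissorsToK0 (C : PolytopeComplex.{v, u}) :
    ScissorsGroup C →+ K0 (cof C) (weq C) :=
  QuotientAddGroup.lift _ (FreeAbelianGroup.lift fun a => K0.of (cof C) (weq C) (single a)) <| by
    rw [AddSubgroup.closure_le]
    rintro _ (⟨x, a, h⟩ | ⟨a, b, σ⟩)
    · simp [k0_single_eq_sum h]
    · simp [k0_single_eq_of_hor σ]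

theorem scissorsToK0_of (a : C.Polytope) :
    scissorsToK0 C (ScissorsGroup.of a) = K0.of (cof C) (weq C) (single a) :=
  FreeAbelianGroup.lift_apply_of _ _

/-- The homomorphism `[{a_i}] ↦ ∑ [a_i]` from `K₀` to the scissors congruence group. -/
noncomputable def k0ToScissors (C : PolytopeComplex.{v, u}) :
    K0 (cof C) (weq C) →+ ScissorsGroup C :=
  QuotientAddGroup.lift _ (FreeAbelianGroup.lift scissorsClass) <| by
    rw [AddSubgroup.closure_le]
    rintro _ (⟨φ, h⟩ | ⟨i, q, h⟩)
    · simp [scissorsClass_eq_of_weq h]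
    · simp [scissorsClass_eq_add h]

theorem k0ToScissors_of (A : SC C) :
    k0ToScissors C (K0.of (cof C) (weq C) A) = scissorsClass A :=
  FreeAbelianGroup.lift_apply_of _ _

theorem k0ToScissors_comp_scissorsToK0 :
    (k0ToScissors C).comp (scissorsToK0 C) = AddMonoidHom.id _ := by
  refine QuotientAddGroup.addMonoidHom_ext _ (FreeAbelianGroup.lift_ext _ _ fun a => ?_)
  change k0ToScissors C (scissorsToK0 C (ScissorsGroup.of a)) = ScissorsGroup.of a
  rw [scissorsToK0_of, k0ToScissors_of, scissorsClass_single]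

theorem scissorsToK0_comp_k0ToScissors :
    (scissorsToK0 C).comp (k0ToScissors C) = AddMonoidHom.id _ := by
  refine QuotientAddGroup.addMonoidHom_ext _ (FreeAbelianGroup.lift_ext _ _ fun A => ?_)
  change scissorsToK0 C (k0ToScissors C (K0.of (cof C) (weq C) A)) = K0.of (cof C) (weq C) A
  rw [k0ToScissors_of, k0_eq_sum, scissorsClass, map_sum]
  simp only [scissorsToK0_of]

/-- The isomorphism `[a] ↦ [{a}]` from the scissors congruence group onto `K₀`. -/
noncomputable def scissorsEquivK0 (C : PolytopeComplex.{v, u}) :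
    ScissorsGroup C ≃+ K0 (cof C) (weq C) :=
  (scissorsToK0 C).toAddEquiv (k0ToScissors C) k0ToScissors_comp_scissorsToK0
    scissorsToK0_comp_k0ToScissors

end K0

end SC

theorem mainTheorem1 :
    (∃ Φ : PolytopeComplex.{v, u} ⥤ WaldCat.{max u v, u}, Φ ⋙ WaldCat.forget = SC.functor) ∧
    ∀ C : PolytopeComplex.{v, u},
      (SC.weq C).HasTwoOutOfThreeProperty ∧
      ExtensionAxiom (SC.cof C) (SC.weq C) ∧
      HasCanonicalSplittings (SC.cof C) (SC.weq C) ∧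
      ∃ e : ScissorsGroup C ≃+ K0 (SC.cof C) (SC.weq C),
        ∀ a : C.Polytope, e (ScissorsGroup.of a) = K0.of (SC.cof C) (SC.weq C) (SC.single a) :=
  ⟨⟨SC.waldFunctor, SC.waldFunctor_comp_forget⟩, fun C =>
    ⟨SC.weq_hasTwoOutOfThreeProperty C, SC.extensionAxiom C, SC.hasCanonicalSplittings C,
      SC.scissorsEquivK0 C, SC.scissorsToK0_of⟩⟩
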